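/- Let $\mathscr G$ be an ample groupoid, that is, a topological groupoid with source map $d$ and range map $r$ whose unit space $\mathscr G^{(0)}$ is locally compact Hausdorff with a basis of compact open sets and whose range map is a local homeomorphism ($\mathscr G$ itself need not be Hausdorff). Let $\mathcal O=(E,p,\alpha)$ be a $\mathscr G$-sheaf of unital rings: $p\colon E\to\mathscr G^{(0)}$ is a local homeomorphism, each stalk $\mathcal O_x=p^{-1}(x)$ is a unital ring, addition, multiplication and the unit section are continuous, and $\mathscr G$ acts continuously on $E$ by ring homomorphisms $\alpha_\gamma\colon\mathcal O_{d(\gamma)}\to\mathcal O_{r(\gamma)}$ with $\alpha_x=\mathrm{id}$ for units $x$ and $\alpha_\beta\alpha_\gamma=\alpha_{\beta\gamma}$ whenever $d(\beta)=r(\gamma)$. Let $\Gamma_c(\mathscr G,\mathcal O)$ be the additive group generated by all maps $f\colon\mathscr G\to E$ with $p\circ f=r$ for which there is a compact open set $U\subseteq\mathscr G$, on which $d$ and $r$ are injective, such that $f|_U$ is continuous and $f$ is zero outside $U$; it is a (not necessarily unital) ring under pointwise addition and the convolution $(f*g)(\gamma)=\sum_{\beta\rho=\gamma}f(\beta)\,\alpha_\beta(g(\rho))$.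 For $x\in\mathscr G^{(0)}$ let $\mathrm{Orb}(x)=r(d^{-1}(x))$, let $\mathscr G^x_x=\{\gamma\in\mathscr G: d(\gamma)=r(\gamma)=x\}$, and let $B_x=\mathcal O_x\rtimes\mathscr G^x_x$ be the skew group ring, with product $(a\delta)(b\varepsilon)=a\,\alpha_\delta(b)\,\delta\varepsilon$. A ring $R$ is left primitive if it has a faithful simple left module, where a left module $M$ is simple if $RM\neq 0$ and its only submodules are $0$ and $M$. 1. If $\Gamma_c(\mathscr G,\mathcal O)$ is left primitive, then there is $x\in\mathscr G^{(0)}$ such that every $f\in\Gamma_c(\mathscr G,\mathcal O)$ that vanishes on $d^{-1}(\mathrm{Orb}(x))$ is zero. 2. If there is $x\in\mathscr G^{(0)}$ such that $B_x$ is left primitive and every $f\in\Gamma_c(\mathscr G,\mathcal O)$ that vanishes on $d^{-1}(\mathrm{Orb}(x))$ is zero, then $\Gamma_c(\mathscr G,\mathcal O)$ is left primitive. -/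

import Mathlib

open CategoryTheory

set_option linter.unusedSectionVars false

universe u v w

namespace AmpleGroupoid

/-! ### Left primitive rings -/

/-- A (not necessarily unital) ring `R` is left primitive if it has a faithful simple left module.
A left module is an abelian group `M` with a ring homomorphism `ρ` from `R` to its additive
endomorphisms; it is faithful if `ρ` is injective, and simple if `R M ≠ 0` and the only
`R`-stable subgroups are `0` and `M`. (A simple module is cyclic, hence isomorphic to a quotient
of `R`, so nothing is lost by taking `M` in the universe of `R`; for a unital `R`, the condition
`R M ≠ 0` forces a simple module to be unital.) -/
def IsLeftPrimitive (R : Type u) [NonUnitalRing R] : Prop :=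
  ∃ (M : Type u) (_ : AddCommGroup M) (ρ : R →ₙ+* AddMonoid.End M),
    Function.Injective ρ ∧
    (∃ r m, ρ r m ≠ 0) ∧
    ∀ N : AddSubgroup M, (∀ r, ∀ n ∈ N, ρ r n ∈ N) → N = ⊥ ∨ N = ⊤

/-! ### Ample groupoids -/

/-- The arrow space of a groupoid with unit space `X`: an arrow has a source `d` and a
range `r`. -/
@[ext]
structure Arr (X : Type u) [Groupoid.{v} X] where
  {d : X}
  {r : X}
  hom : d ⟶ r

section Groupoids

variable (X : Type u) [Groupoid.{v} X]

/-- The pullback `{(β, γ) | d β = r γ}` of composable pairs of arrows. -/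
structure CompPair where
  {a : X}
  {b : X}
  {c : X}
  β : b ⟶ c
  γ : a ⟶ b

variable {X}

/-- The unit arrow at `x`. -/
def Arr.unit (x : X) : Arr X := ⟨𝟙 x⟩

/-- The inverse arrow. -/
def Arr.inv (γ : Arr X) : Arr X := ⟨Groupoid.inv γ.hom⟩

/-- The product `βγ` (first `γ`, then `β`) of a composable pair. -/
def CompPair.prod (q : CompPair X) : Arr X := ⟨q.γ ≫ q.β⟩

/-- A composable pair as a pair of arrows. -/
def CompPair.toPair (q : CompPair X) : Arr X × Arr X := (⟨q.β⟩, ⟨q.γ⟩)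

/-- The set of composable pairs has the subspace topology of the product. -/
instance [TopologicalSpace (Arr X)] : TopologicalSpace (CompPair X) :=
  TopologicalSpace.induced CompPair.toPair inferInstance

/-- The orbit `r(d⁻¹(x))` of a unit. -/
def Orb (x : X) : Set X := Arr.r '' {γ : Arr X | γ.d = x}

/-- A bisection: a set of arrows on which source and range are injective. -/
def IsBisection (U : Set (Arr X)) : Prop := Set.InjOn Arr.d U ∧ Set.InjOn Arr.r U

/-- A groupoid with a topology on its arrow space for which multiplication and inversion are
continuous; the unit space has the topology of the subspace of unit arrows. -/
class IsTopologicalGroupoid (X : Type u) [Groupoid.{v} X] [TopologicalSpace X]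
    [TopologicalSpace (Arr X)] : Prop where
  isEmbedding_unit : Topology.IsEmbedding (Arr.unit : X → Arr X)
  continuous_prod : Continuous (CompPair.prod : CompPair X → Arr X)
  continuous_inv : Continuous (Arr.inv : Arr X → Arr X)

/-- An étale groupoid: the unit space is locally compact and Hausdorff, and the range map is a
local homeomorphism. -/
class IsEtaleGroupoid (X : Type u) [Groupoid.{v} X] [TopologicalSpace X]
    [TopologicalSpace (Arr X)] : Prop extends IsTopologicalGroupoid X where
  t2 : T2Space X
  locallyCompact : LocallyCompactSpace X
  isLocalHomeomorph_r : IsLocalHomeomorph (Arr.r : Arr X → X)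

/-- An ample groupoid: an étale groupoid whose unit space has a basis of compact open sets. -/
class IsAmpleGroupoid (X : Type u) [Groupoid.{v} X] [TopologicalSpace X]
    [TopologicalSpace (Arr X)] : Prop extends IsEtaleGroupoid X where
  basis : TopologicalSpace.IsTopologicalBasis {U : Set X | IsCompact U ∧ IsOpen U}

end Groupoids

/-! ### Sheaves of rings -/

/-- The total space `E` of a family of stalks. -/
structure Total {X : Type u} (O : X → Type w) where
  {pt : X}
  val : O pt

/-- The pullback `{(e, e') | p e = p e'}` of the total space with itself. -/
structure TotalPair {X : Type u} (O : X → Type w) where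
  {pt : X}
  fst : O pt
  snd : O pt

/-- The pullback `{(γ, e) | d γ = p e}` of the arrow space and the total space. -/
structure ArrTotal (X : Type u) [Groupoid.{v} X] (O : X → Type w) where
  {a : X}
  {b : X}
  γ : a ⟶ b
  val : O a

section Pullbacks

variable {X : Type u} {O : X → Type w}

/-- An element of the pullback as a pair. -/
def TotalPair.toPair (q : TotalPair O) : Total O × Total O := (⟨q.fst⟩, ⟨q.snd⟩)

/-- The subspace topology of the product. -/
instance [TopologicalSpace (Total O)] : TopologicalSpace (TotalPair O) :=
  TopologicalSpace.induced TotalPair.toPair inferInstance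

variable [Groupoid.{v} X]

/-- An element of the pullback as a pair. -/
def ArrTotal.toPair (q : ArrTotal X O) : Arr X × Total O := (⟨q.γ⟩, ⟨q.val⟩)

/-- The subspace topology of the product. -/
instance [TopologicalSpace (Arr X)] [TopologicalSpace (Total O)] :
    TopologicalSpace (ArrTotal X O) :=
  TopologicalSpace.induced ArrTotal.toPair inferInstance

end Pullbacks

/-- A sheaf of unital rings over a topological groupoid with unit space `X`: a family of rings
(the stalks), a topology on their disjoint union `E` for which the projection `p : E → X` is a
local homeomorphism and the ring operations and the unit section are continuous, and a continuous
action of the groupoid by ring homomorphisms between stalks. -/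
structure RingSheaf (X : Type u) [Groupoid.{v} X] [TopologicalSpace X]
    [TopologicalSpace (Arr X)] where
  stalk : X → Type w
  [ring : ∀ x, Ring (stalk x)]
  [top : TopologicalSpace (Total stalk)]
  isLocalHomeomorph_pt : IsLocalHomeomorph (Total.pt : Total stalk → X)
  act : ∀ {x y : X}, (x ⟶ y) → stalk x →+* stalk y
  act_id : ∀ (x : X) (a : stalk x), act (𝟙 x) a = a
  act_comp : ∀ {x y z : X} (γ : x ⟶ y) (β : y ⟶ z) (a : stalk x),
    act (γ ≫ β) a = act β (act γ a)
  continuous_act :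
    Continuous (fun q : ArrTotal X stalk => (⟨act q.γ q.val⟩ : Total stalk))
  continuous_add :
    Continuous (fun q : TotalPair stalk => (⟨q.fst + q.snd⟩ : Total stalk))
  continuous_mul :
    Continuous (fun q : TotalPair stalk => (⟨q.fst * q.snd⟩ : Total stalk))
  continuous_one : Continuous (fun x : X => (⟨(1 : stalk x)⟩ : Total stalk))

namespace RingSheaf

variable {X : Type u} [Groupoid.{v} X] [TopologicalSpace X] [TopologicalSpace (Arr X)]

attribute [instance] RingSheaf.ring RingSheaf.top

variable (O : RingSheaf.{u, v, w} X)

/-! ### The isotropy skew group rings -/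

/-- The isotropy group at `x` acts on the stalk at `x` by ring automorphisms. -/
instance (x : X) : MulSemiringAction (End x) (O.stalk x) where
  smul δ a := O.act δ a
  one_smul a := O.act_id x a
  mul_smul δ ε a := O.act_comp ε δ a
  smul_zero δ := map_zero (O.act δ)
  smul_add δ a b := map_add (O.act δ) a b
  smul_one δ := map_one (O.act δ)
  smul_mul δ a b := map_mul (O.act δ) a b

/-- The isotropy skew group ring `B_x`, the skew group ring of the isotropy group at `x` over the
stalk at `x`, with product `(a δ) (b ε) = (a α_δ(b)) (δ ε)`. -/
abbrev isotropyRing (x : X) : Type (max v w) := SkewMonoidAlgebra (O.stalk x) (End x)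

/-! ### The convolution ring -/

/-- The maps `f` from the arrow space to `E` with `p ∘ f = r`. -/
abbrev Sec : Type (max u v w) := ∀ γ : Arr X, O.stalk γ.r

variable {O}

/-- `f` is supported on `U`: it is continuous on `U` and zero outside `U`. -/
def IsSupportedOn (f : O.Sec) (U : Set (Arr X)) : Prop :=
  ContinuousOn (fun γ => (⟨f γ⟩ : Total O.stalk)) U ∧ ∀ γ, γ ∉ U → f γ = 0

/-- The generators: sections supported on a compact open bisection. (Such a set is homeomorphic
to a subspace of the unit space, so it is automatically Hausdorff.) -/
def IsGenerator (f : O.Sec) : Prop :=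
  ∃ U : Set (Arr X), IsCompact U ∧ IsOpen U ∧ IsBisection U ∧ IsSupportedOn f U

variable (O) in
/-- `Γ_c(𝒢, 𝒪)` as an additive group. -/
def sections : AddSubgroup O.Sec := AddSubgroup.closure {f | IsGenerator f}

/-- The convolution `(f * g)(γ) = ∑ f(β) α_β(g(ρ))` over all factorizations `γ = βρ`,
which are indexed by the arrows `β` with `r(β) = r(γ)`, with `ρ = β⁻¹γ`. -/
noncomputable def conv (f g : O.Sec) : O.Sec := fun γ =>
  ∑ᶠ b : Σ y : X, (y ⟶ γ.r), f ⟨b.2⟩ * O.act b.2 (g ⟨γ.hom ≫ Groupoid.inv b.2⟩)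


section ConvolutionRing

/-! #### `Γ_c(𝒢, 𝒪)` is closed under convolution, which is bilinear and associative -/

theorem conv_of_mem {f : O.Sec} {U : Set (Arr X)} (hU : IsBisection U)
    (hf : ∀ γ, γ ∉ U → f γ = 0) (g : O.Sec) (γ : Arr X) {y : X} (β : y ⟶ γ.r)
    (hβ : (⟨β⟩ : Arr X) ∈ U) :
    conv f g γ = f ⟨β⟩ * O.act β (g ⟨γ.hom ≫ Groupoid.inv β⟩) := by
  unfold conv
  rw [finsum_eq_single _ (⟨y, β⟩ : Σ y : X, (y ⟶ γ.r))]
  rintro ⟨z, b⟩ hne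
  have hb : (⟨b⟩ : Arr X) ∉ U := by
    intro hb
    apply hne
    have h := hU.2 hb hβ rfl
    injection h with h1 _ h3
    subst h1
    rw [eq_of_heq h3]
  simp [hf _ hb]

theorem conv_of_not_mem {f : O.Sec} {U : Set (Arr X)}
    (hf : ∀ γ, γ ∉ U → f γ = 0) (g : O.Sec) (γ : Arr X)
    (h : ∀ (y : X) (β : y ⟶ γ.r), (⟨β⟩ : Arr X) ∉ U) : conv f g γ = 0 := by
  unfold conv
  rw [← finsum_zero (α := Σ y : X, (y ⟶ γ.r))]
  refine finsum_congr ?_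
  rintro ⟨y, b⟩
  simp [hf _ (h y b)]

theorem finite_fiber {f : O.Sec} (hf : f ∈ O.sections) (x : X) :
    {b : Σ y : X, (y ⟶ x) | f ⟨b.2⟩ ≠ 0}.Finite := by
  induction hf using AddSubgroup.closure_induction with
  | mem f hf =>
    obtain ⟨U, -, -, hU, hs⟩ := hf
    apply Set.Subsingleton.finite
    rintro ⟨y, b⟩ hb ⟨z, c⟩ hc
    have h1 : (⟨b⟩ : Arr X) ∈ U := by by_contra h; exact hb (hs.2 _ h)
    have h2 : (⟨c⟩ : Arr X) ∈ U := by by_contra h; exact hc (hs.2 _ h)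
    have h := hU.2 h1 h2 rfl
    injection h with h1 _ h3
    subst h1
    rw [eq_of_heq h3]
  | zero => simp
  | add f g _ _ hf hg =>
    refine (hf.union hg).subset ?_
    intro b hb
    by_contra h
    simp only [Set.mem_union, Set.mem_ofPred_eq, not_or, not_not] at h
    exact hb (by simp [h.1, h.2])
  | neg f _ hf => simpa using hf

theorem finite_conv_support {f : O.Sec} (hf : f ∈ O.sections) (g : O.Sec) (γ : Arr X) :
    (Function.support (M := O.stalk γ.r) fun b : Σ y : X, (y ⟶ γ.r) =>
      f ⟨b.2⟩ * O.act b.2 (g ⟨γ.hom ≫ Groupoid.inv b.2⟩)).Finite := by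
  refine (finite_fiber hf γ.r).subset ?_
  intro b hb h0
  exact hb (by simp [h0])

theorem zero_conv (g : O.Sec) : conv 0 g = 0 := by
  funext γ
  simp [conv]

theorem conv_zero (f : O.Sec) : conv f 0 = 0 := by
  funext γ
  simp [conv]

theorem add_conv {f f' : O.Sec} (hf : f ∈ O.sections) (hf' : f' ∈ O.sections) (g : O.Sec) :
    conv (f + f') g = conv f g + conv f' g := by
  funext γ
  simp only [conv, Pi.add_apply]
  rw [← finsum_add_distrib (finite_conv_support hf g γ) (finite_conv_support hf' g γ)]
  simp [add_mul]

theorem conv_add {f : O.Sec} (hf : f ∈ O.sections) (g g' : O.Sec) :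
    conv f (g + g') = conv f g + conv f g' := by
  funext γ
  simp only [conv, Pi.add_apply]
  rw [← finsum_add_distrib (finite_conv_support hf g γ) (finite_conv_support hf g' γ)]
  simp [mul_add]

theorem neg_conv (f g : O.Sec) : conv (-f) g = -conv f g := by
  funext γ
  simp only [conv, Pi.neg_apply]
  rw [← finsum_neg_distrib]
  simp

theorem conv_neg (f g : O.Sec) : conv f (-g) = -conv f g := by
  funext γ
  simp only [conv, Pi.neg_apply]
  rw [← finsum_neg_distrib]
  simp

theorem conv_assoc_of_generator {f : O.Sec} (hf : IsGenerator f) {g : O.Sec}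
    (hg : g ∈ O.sections) (h : O.Sec) : conv (conv f g) h = conv f (conv g h) := by
  obtain ⟨U, -, -, hU, hs⟩ := hf
  funext γ
  by_cases hγ : ∃ (y : X) (β : y ⟶ γ.r), (⟨β⟩ : Arr X) ∈ U
  · obtain ⟨y, β, hβ⟩ := hγ
    rw [conv_of_mem hU hs.2 _ γ β hβ]
    have h1 : ∀ b : Σ z : X, (z ⟶ γ.r), conv f g ⟨b.2⟩ =
        f ⟨β⟩ * O.act β (g ⟨b.2 ≫ Groupoid.inv β⟩) := fun b =>
      conv_of_mem hU hs.2 g ⟨b.2⟩ β hβ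
    have h2 : conv (conv f g) h γ = ∑ᶠ b : Σ z : X, (z ⟶ γ.r),
        (f ⟨β⟩ * O.act β (g ⟨b.2 ≫ Groupoid.inv β⟩)) *
          O.act b.2 (h ⟨γ.hom ≫ Groupoid.inv b.2⟩) :=
      finsum_congr fun b => by rw [h1]
    rw [h2]
    let e : (Σ z : X, (z ⟶ y)) ≃ (Σ z : X, (z ⟶ γ.r)) :=
      { toFun := fun c => ⟨c.1, c.2 ≫ β⟩
        invFun := fun b => ⟨b.1, b.2 ≫ Groupoid.inv β⟩
        left_inv := fun c => by simp
        right_inv := fun b => by simp }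
    rw [← finsum_comp_equiv e]
    let φ : O.stalk y →+ O.stalk γ.r :=
      (AddMonoidHom.mulLeft (f ⟨β⟩)).comp (O.act β).toAddMonoidHom
    have h3 := φ.map_finsum (finite_conv_support hg h ⟨γ.hom ≫ Groupoid.inv β⟩)
    refine Eq.trans ?_ h3.symm
    refine finsum_congr fun c => ?_
    change (f ⟨β⟩ * O.act β (g ⟨(c.2 ≫ β) ≫ Groupoid.inv β⟩)) *
        O.act (c.2 ≫ β) (h ⟨γ.hom ≫ Groupoid.inv (c.2 ≫ β)⟩) =
      f ⟨β⟩ * O.act β (g ⟨c.2⟩ *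
        O.act c.2 (h ⟨(γ.hom ≫ Groupoid.inv β) ≫ Groupoid.inv c.2⟩))
    have h4 : (c.2 ≫ β) ≫ Groupoid.inv β = c.2 := by simp
    have h5 : γ.hom ≫ Groupoid.inv (c.2 ≫ β) =
        (γ.hom ≫ Groupoid.inv β) ≫ Groupoid.inv c.2 := by
      simp [Groupoid.inv_eq_inv]
    rw [h4, h5, O.act_comp, map_mul, mul_assoc]
  · push Not at hγ
    rw [conv_of_not_mem hs.2 _ γ hγ]
    have h1 : ∀ b : Σ z : X, (z ⟶ γ.r), conv f g ⟨b.2⟩ = 0 := fun b =>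
      conv_of_not_mem hs.2 g ⟨b.2⟩ hγ
    unfold conv at h1 ⊢
    rw [← finsum_zero (α := Σ y : X, (y ⟶ γ.r))]
    exact finsum_congr fun b => by rw [h1, zero_mul]

section Closure

variable [IsAmpleGroupoid X]

theorem continuous_r : Continuous (Arr.r : Arr X → X) :=
  IsEtaleGroupoid.isLocalHomeomorph_r.continuous

theorem continuous_d : Continuous (Arr.d : Arr X → X) :=
  (continuous_r (X := X)).comp IsTopologicalGroupoid.continuous_inv

/-- The map `(β, γ) ↦ β⁻¹γ` on pairs of arrows with the same range. -/
def div (p : {p : Arr X × Arr X // p.1.r = p.2.r}) : Arr X :=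
  ⟨(p.1.2.hom ≫ eqToHom p.2.symm) ≫ Groupoid.inv p.1.1.hom⟩

theorem continuous_div : Continuous (div : {p : Arr X × Arr X // p.1.r = p.2.r} → Arr X) := by
  have h : Continuous (fun p : {p : Arr X × Arr X // p.1.r = p.2.r} =>
      (⟨Groupoid.inv p.1.1.hom, p.1.2.hom ≫ eqToHom p.2.symm⟩ : CompPair X)) := by
    refine continuous_induced_rng.2 ?_
    have h2 : (CompPair.toPair ∘ fun p : {p : Arr X × Arr X // p.1.r = p.2.r} =>
        (⟨Groupoid.inv p.1.1.hom, p.1.2.hom ≫ eqToHom p.2.symm⟩ : CompPair X)) =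
        fun p => (p.1.1.inv, p.1.2) := by
      funext ⟨⟨⟨α⟩, ⟨γ⟩⟩, hp⟩
      dsimp at hp
      subst hp
      simp [CompPair.toPair, Arr.inv]
    rw [h2]
    exact (IsTopologicalGroupoid.continuous_inv.comp
      (continuous_fst.comp continuous_subtype_val)).prodMk
        (continuous_snd.comp continuous_subtype_val)
  exact IsTopologicalGroupoid.continuous_prod.comp h

/-- The product `UV` of two sets of arrows. -/
def mulSet (U V : Set (Arr X)) : Set (Arr X) :=
  CompPair.prod '' (CompPair.toPair ⁻¹' (U ×ˢ V))

theorem isCompact_mulSet {U V : Set (Arr X)} (hU : IsCompact U) (hV : IsCompact V) :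
    IsCompact (mulSet U V) := by
  have : T2Space X := IsEtaleGroupoid.t2
  refine IsCompact.image ?_ IsTopologicalGroupoid.continuous_prod
  have hi : Topology.IsInducing (CompPair.toPair : CompPair X → _) := ⟨rfl⟩
  rw [hi.isCompact_iff]
  have h : CompPair.toPair '' (CompPair.toPair ⁻¹' (U ×ˢ V)) =
      (U ×ˢ V) ∩ {p : Arr X × Arr X | p.1.d = p.2.r} := by
    ext ⟨⟨β⟩, ⟨γ⟩⟩
    constructor
    · rintro ⟨q, hq, hq2⟩
      rw [← hq2]
      exact ⟨hq, rfl⟩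
    · rintro ⟨h1, h2⟩
      dsimp at h2
      subst h2
      exact ⟨⟨β, γ⟩, h1, rfl⟩
  rw [h]
  exact (hU.prod hV).inter_right
    (isClosed_eq (continuous_d.comp continuous_fst) (continuous_r.comp continuous_snd))

theorem isBisection_mulSet {U V : Set (Arr X)} (hU : IsBisection U) (hV : IsBisection V) :
    IsBisection (mulSet U V) := by
  constructor
  · rintro _ ⟨⟨β, γ⟩, ⟨h1, h2⟩, rfl⟩ _ ⟨⟨β', γ'⟩, ⟨h1', h2'⟩, rfl⟩ h
    have h3 := hV.1 h2 h2' h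
    injection h3 with a b c
    subst a b
    have h4 := hU.1 h1 h1' rfl
    injection h4 with a' b' c'
    subst b'
    obtain rfl := eq_of_heq c
    obtain rfl := eq_of_heq c'
    rfl
  · rintro _ ⟨⟨β, γ⟩, ⟨h1, h2⟩, rfl⟩ _ ⟨⟨β', γ'⟩, ⟨h1', h2'⟩, rfl⟩ h
    have h3 := hU.2 h1 h1' h
    injection h3 with a b c
    subst a b
    have h4 := hV.2 h2 h2' rfl
    injection h4 with a' b' c'
    subst a'
    obtain rfl := eq_of_heq c
    obtain rfl := eq_of_heq c'
    rfl

/-- On the arrows whose range is in `r(U)`, the arrow of `U` with the same range is a continuous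
function. -/
theorem exists_lift {U : Set (Arr X)} (hU : IsOpen U) (hb : IsBisection U) :
    ∃ σ : {γ : Arr X // γ.r ∈ Arr.r '' U} → {p : Arr X × Arr X // p.1.r = p.2.r},
      Continuous σ ∧ ∀ γ, (σ γ).1.2 = γ.1 ∧ (σ γ).1.1 ∈ U := by
  have hl : IsLocalHomeomorph (fun γ : U => γ.1.r) :=
    (IsEtaleGroupoid.isLocalHomeomorph_r (X := X)).comp
      hU.isOpenEmbedding_subtypeVal.isLocalHomeomorph
  have he := hl.isOpenEmbedding_of_injective
    (fun a b h => Subtype.ext (hb.2 a.2 b.2 h))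
  let e := he.toHomeomorph
  have hmem : ∀ γ : {γ : Arr X // γ.r ∈ Arr.r '' U},
      γ.1.r ∈ Set.range (fun γ : U => γ.1.r) := by
    rintro ⟨γ, β, hβ, h⟩
    exact ⟨⟨β, hβ⟩, h⟩
  have hr : ∀ γ : {γ : Arr X // γ.r ∈ Arr.r '' U},
      (e.symm ⟨γ.1.r, hmem γ⟩).1.r = γ.1.r := fun γ =>
    congrArg Subtype.val (e.apply_symm_apply ⟨γ.1.r, hmem γ⟩)
  refine ⟨fun γ => ⟨((e.symm ⟨γ.1.r, hmem γ⟩).1, γ.1), hr γ⟩, ?_, fun γ => ⟨rfl, ?_⟩⟩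
  · refine Continuous.subtype_mk (Continuous.prodMk ?_ continuous_subtype_val) _
    exact continuous_subtype_val.comp (e.symm.continuous.comp
      ((continuous_r.comp continuous_subtype_val).subtype_mk _))
  · exact (e.symm ⟨γ.1.r, hmem γ⟩).2

theorem mem_mulSet_iff {U V : Set (Arr X)} (hb : IsBisection U)
    (p : {p : Arr X × Arr X // p.1.r = p.2.r}) (hp : p.1.1 ∈ U) :
    p.1.2 ∈ mulSet U V ↔ div p ∈ V := by
  obtain ⟨⟨⟨α⟩, ⟨γ⟩⟩, h⟩ := p
  dsimp at h hp ⊢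
  subst h
  constructor
  · rintro ⟨⟨β, ρ⟩, ⟨h1, h2⟩, h3⟩
    injection h3 with a b c
    subst a b
    cases c
    have h4 := hb.2 h1 hp rfl
    injection h4 with a' b' c'
    subst a'
    cases c'
    simpa [div, CompPair.toPair] using h2
  · intro h
    refine ⟨⟨α, γ ≫ Groupoid.inv α⟩, ⟨hp, ?_⟩, ?_⟩
    · simpa [div, CompPair.toPair] using h
    · simp [CompPair.prod]

theorem isOpen_mulSet {U V : Set (Arr X)} (hU : IsOpen U) (hV : IsOpen V)
    (hb : IsBisection U) : IsOpen (mulSet U V) := by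
  obtain ⟨σ, hσ, hσ2⟩ := exists_lift hU hb
  have ho : IsOpen {γ : Arr X | γ.r ∈ Arr.r '' U} :=
    ((IsEtaleGroupoid.isLocalHomeomorph_r (X := X)).isOpenMap U hU).preimage continuous_r
  have h : mulSet U V = Subtype.val '' ((div ∘ σ) ⁻¹' V) := by
    ext γ
    constructor
    · intro hγ
      have hr : γ.r ∈ Arr.r '' U := by
        obtain ⟨⟨β, ρ⟩, ⟨h1, h2⟩, rfl⟩ := hγ
        exact ⟨⟨β⟩, h1, rfl⟩
      refine ⟨⟨γ, hr⟩, ?_, rfl⟩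
      refine (mem_mulSet_iff hb _ (hσ2 _).2).1 ?_
      rw [(hσ2 _).1]
      exact hγ
    · rintro ⟨γ, hγ, rfl⟩
      have := (mem_mulSet_iff hb (σ γ) (hσ2 _).2).2 hγ
      rwa [(hσ2 _).1] at this
  rw [h]
  exact ho.isOpenMap_subtype_val _ (hV.preimage (continuous_div.comp hσ))

theorem conv_generator {f g : O.Sec} (hf : IsGenerator f) (hg : IsGenerator g) :
    IsGenerator (conv f g) := by
  obtain ⟨U, hUc, hUo, hUb, hfc, hf0⟩ := hf
  obtain ⟨V, hVc, hVo, hVb, hgc, hg0⟩ := hg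
  refine ⟨mulSet U V, isCompact_mulSet hUc hVc, isOpen_mulSet hUo hVo hUb,
    isBisection_mulSet hUb hVb, ?_, ?_⟩
  · obtain ⟨σ, hσ, hσ2⟩ := exists_lift hUo hUb
    have hr : ∀ γ : mulSet U V, γ.1.r ∈ Arr.r '' U := by
      rintro ⟨_, ⟨β, ρ⟩, ⟨h1, h2⟩, rfl⟩
      exact ⟨⟨β⟩, h1, rfl⟩
    let τ : mulSet U V → {p : Arr X × Arr X // p.1.r = p.2.r} := fun γ => σ ⟨γ.1, hr γ⟩
    have hτ : Continuous τ := hσ.comp (continuous_subtype_val.subtype_mk _)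
    have hτ1 : ∀ γ, (τ γ).1.2 = γ.1 := fun γ => (hσ2 _).1
    have hτU : ∀ γ, (τ γ).1.1 ∈ U := fun γ => (hσ2 _).2
    have hτV : ∀ γ, div (τ γ) ∈ V := fun γ =>
      (mem_mulSet_iff hUb _ (hτU γ)).1 (by rw [hτ1]; exact γ.2)
    have hα : Continuous fun γ : mulSet U V => (τ γ).1.1 :=
      continuous_fst.comp (continuous_subtype_val.comp hτ)
    have c1 : Continuous fun γ : mulSet U V => (⟨f (τ γ).1.1⟩ : Total O.stalk) :=
      hfc.comp_continuous hα hτU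
    have c2 : Continuous fun γ : mulSet U V => (⟨g (div (τ γ))⟩ : Total O.stalk) :=
      hgc.comp_continuous (continuous_div.comp hτ) hτV
    have c3 : Continuous fun γ : mulSet U V =>
        (⟨(τ γ).1.1.hom, g (div (τ γ))⟩ : ArrTotal X O.stalk) :=
      continuous_induced_rng.2 (hα.prodMk c2)
    have c4 := O.continuous_act.comp c3
    have c5 : Continuous fun γ : mulSet U V =>
        (⟨f (τ γ).1.1, O.act (τ γ).1.1.hom (g (div (τ γ)))⟩ : TotalPair O.stalk) :=
      continuous_induced_rng.2 (c1.prodMk c4)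
    have c6 := O.continuous_mul.comp c5
    rw [continuousOn_iff_continuous_domRestrict]
    convert c6 using 1
    funext γ
    have key : ∀ p : {p : Arr X × Arr X // p.1.r = p.2.r}, p.1.1 ∈ U →
        (⟨conv f g p.1.2⟩ : Total O.stalk) =
          ⟨f p.1.1 * O.act p.1.1.hom (g (div p))⟩ := by
      rintro ⟨⟨⟨α⟩, ⟨γ⟩⟩, h⟩ hp
      dsimp at h hp
      subst h
      rw [conv_of_mem hUb hf0 g ⟨γ⟩ α hp]
      simp only [div, eqToHom_refl]
      rw [Category.comp_id]
    have := key (τ γ) (hτU γ)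
    rw [hτ1] at this
    exact this
  · intro γ hγ
    by_cases h : ∃ (y : X) (β : y ⟶ γ.r), (⟨β⟩ : Arr X) ∈ U
    · obtain ⟨y, β, hβ⟩ := h
      rw [conv_of_mem hUb hf0 g γ β hβ]
      have : (⟨γ.hom ≫ Groupoid.inv β⟩ : Arr X) ∉ V := by
        intro h
        exact hγ ⟨⟨β, γ.hom ≫ Groupoid.inv β⟩, ⟨hβ, h⟩, by simp [CompPair.prod]⟩
      rw [hg0 _ this, map_zero, mul_zero]
    · push Not at h
      exact conv_of_not_mem hf0 g γ h

theorem conv_mem {f g : O.Sec} (hf : f ∈ O.sections) (hg : g ∈ O.sections) :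
    conv f g ∈ O.sections := by
  have hf' := hf
  induction hf using AddSubgroup.closure_induction with
  | mem f hfg =>
    have hg' := hg
    induction hg using AddSubgroup.closure_induction with
    | mem g hgg => exact AddSubgroup.subset_closure (conv_generator hfg hgg)
    | zero => rw [conv_zero]; exact zero_mem _
    | add g g' h1 h2 ih1 ih2 => rw [conv_add hf']; exact add_mem (ih1 h1) (ih2 h2)
    | neg g h1 ih => rw [conv_neg]; exact neg_mem (ih h1)
  | zero => rw [zero_conv]; exact zero_mem _
  | add f f' h1 h2 ih1 ih2 => rw [add_conv h1 h2]; exact add_mem (ih1 h1) (ih2 h2)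
  | neg f h1 ih => rw [neg_conv]; exact neg_mem (ih h1)

theorem conv_assoc {f g : O.Sec} (hf : f ∈ O.sections) (hg : g ∈ O.sections) (h : O.Sec) :
    conv (conv f g) h = conv f (conv g h) := by
  induction hf using AddSubgroup.closure_induction with
  | mem f hf => exact conv_assoc_of_generator hf hg h
  | zero => simp only [zero_conv]
  | add f f' h1 h2 ih1 ih2 =>
    rw [add_conv h1 h2, add_conv (conv_mem h1 hg) (conv_mem h2 hg), add_conv h1 h2, ih1, ih2]
  | neg f h1 ih => simp only [neg_conv, ih]

end Closure

end ConvolutionRing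

variable (O) in
/-- The convolution ring `Γ_c(𝒢, 𝒪)`. -/
def Gamma : Type (max u v w) := O.sections

instance : CoeFun O.Gamma (fun _ => ∀ γ : Arr X, O.stalk γ.r) := ⟨fun f => f.1⟩

instance : AddCommGroup O.Gamma := inferInstanceAs (AddCommGroup O.sections)

/-- Addition is pointwise and multiplication is convolution. -/
noncomputable instance [IsAmpleGroupoid X] : NonUnitalRing O.Gamma :=
  { (inferInstance : AddCommGroup O.Gamma) with
    mul := fun f g => ⟨conv f.1 g.1, conv_mem f.2 g.2⟩
    left_distrib := fun f g h => Subtype.ext (conv_add f.2 g.1 h.1)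
    right_distrib := fun f g h => Subtype.ext (add_conv f.2 g.2 h.1)
    zero_mul := fun f => Subtype.ext (zero_conv f.1)
    mul_zero := fun f => Subtype.ext (conv_zero f.1)
    mul_assoc := fun f g h => Subtype.ext (conv_assoc f.2 g.2 h.1) }

end RingSheaf

end AmpleGroupoid

/-! Part 1. Let `M` be a faithful simple module. For a unit `x`, `stalkKernel` consists of the `m`
killed by all `g` with sources in some neighbourhood of `x`; it is only a subgroup. If `m` lay in it
for every `x`, compactness and clopen partitions would show that the whole ring kills `m`
(`map_eq_zero_of_mem_stalkKernel`); so simplicity provides `m` and `x` with `m` outside it. The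
elements vanishing on `d⁻¹(Orb x)` form a left ideal `I`, so `IM` is a submodule. They vanish on
`r⁻¹(x)`, hence over a neighbourhood of `x` (`mem_vanishingNear`), which puts `IM` inside
`stalkKernel` at `x`. Thus `IM` misses `m`, so `IM = 0`, and `I = 0` by faithfulness. The delicate
point is `mem_vanishingNear`: elements need not be continuous when the groupoid is not Hausdorff.

Part 2. A faithful simple `B_x`-module `V` is induced to equivariant maps `φ : d⁻¹(x) → V`, `φ(γδ) =
δ⁻¹φ(γ)`, supported on finitely many fibres of `r`. An element `f` acts by the matrix
`α_{γ⁻¹}(f(γη⁻¹))` with entries in the stalk at `x`; convolution becomes matrix multiplication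
(`kernel_conv`). Generators with small support move one nonzero value of `φ` to any fibre while
ignoring the other fibres (`exists_inducedRep_eq_bump`), so simplicity of `V` passes to the induced
module. If `f` acts as zero, suitable matrix entries assemble to an element of `B_x` killing `V`, so
`f` vanishes on `d⁻¹(Orb x)` (`apply_eq_zero_of_inducedRep_eq_zero`), and the hypothesis gives `f =
0`. -/

namespace AmpleGroupoid

namespace RingSheaf

open Topology Filter

/-! ### Continuous local sections of the sheaf. -/

section Stalks

variable {X : Type u} [Groupoid.{v} X] [TopologicalSpace X] [TopologicalSpace (Arr X)]
  {O : RingSheaf.{u, v, w} X}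

/-- Through every point of the total space there is a continuous local section. -/
theorem exists_local_section (x : X) (a : O.stalk x) :
    ∃ (s : ∀ y, O.stalk y) (U : Set X), IsOpen U ∧ x ∈ U ∧ s x = a ∧
      ContinuousOn (fun y => (⟨s y⟩ : Total O.stalk)) U := by
  classical
  obtain ⟨e, he, hpt⟩ := O.isLocalHomeomorph_pt ⟨a⟩
  have hex : ∀ y ∈ e.target, (e.symm y).pt = y := fun y hy => by
    rw [hpt]; exact e.right_inv hy
  -- Off the chart the value 0 is arbitrary; continuity is only claimed on `e.target`.
  let s : ∀ y, O.stalk y := fun y => if h : y ∈ e.target then hex y h ▸ (e.symm y).val else 0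
  have hs : ∀ y ∈ e.target, (⟨s y⟩ : Total O.stalk) = e.symm y := by
    intro y hy
    simp only [s, dif_pos hy]
    have : ∀ (t : Total O.stalk) (h : t.pt = y), (⟨h ▸ t.val⟩ : Total O.stalk) = t := by
      rintro ⟨t⟩ rfl
      rfl
    exact this _ _
  have hx : x ∈ e.target := by
    have := e.map_source he
    rwa [← hpt] at this
  refine ⟨s, e.target, e.open_target, hx, ?_, e.continuousOn_symm.congr hs⟩
  have h1 : (⟨s x⟩ : Total O.stalk) = ⟨a⟩ := by
    rw [hs x hx]
    have := e.left_inv he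
    rwa [← hpt] at this
  injection h1

/-- Two sections that are continuous at a point and agree there, agree near this point. -/
theorem eventually_eq_of_continuousAt {Y : Type*} [TopologicalSpace Y] {π : Y → X}
    {f g : ∀ y, O.stalk (π y)} {y : Y}
    (hf : ContinuousAt (fun y => (⟨f y⟩ : Total O.stalk)) y)
    (hg : ContinuousAt (fun y => (⟨g y⟩ : Total O.stalk)) y) (h : f y = g y) :
    ∀ᶠ z in 𝓝 y, f z = g z := by
  obtain ⟨e, he, hpt⟩ := O.isLocalHomeomorph_pt ⟨f y⟩
  filter_upwards [hf.eventually (e.open_source.mem_nhds he),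
    hg.eventually (e.open_source.mem_nhds (by beta_reduce; rwa [← h]))] with z h1 h2
  have h3 := e.injOn h1 h2 (by rw [← hpt])
  injection h3

theorem continuousAt_add {Y : Type*} [TopologicalSpace Y] {π : Y → X}
    {f g : ∀ y, O.stalk (π y)} {y : Y}
    (hf : ContinuousAt (fun y => (⟨f y⟩ : Total O.stalk)) y)
    (hg : ContinuousAt (fun y => (⟨g y⟩ : Total O.stalk)) y) :
    ContinuousAt (fun y => (⟨f y + g y⟩ : Total O.stalk)) y := by
  have h : ContinuousAt (fun y => (⟨f y, g y⟩ : TotalPair O.stalk)) y := by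
    have hi : IsInducing (TotalPair.toPair : TotalPair O.stalk → _) := ⟨rfl⟩
    exact hi.continuousAt_iff.2 (hf.prodMk hg)
  exact O.continuous_add.continuousAt.comp h

/-- Continuity of zero is not an axiom of `RingSheaf`. A local section `s` with `s x = 0` satisfies
`s + s = s` at `x`, hence near `x`, so it is the zero section there. -/
theorem continuous_zero : Continuous (fun x : X => (⟨(0 : O.stalk x)⟩ : Total O.stalk)) := by
  rw [continuous_iff_continuousAt]
  intro x
  obtain ⟨s, U, hU, hx, h0, hs⟩ := exists_local_section (O := O) x 0
  have hs' := hs.continuousAt (hU.mem_nhds hx)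
  have h := eventually_eq_of_continuousAt (π := id) (continuousAt_add (π := id) hs' hs') hs'
    (by simp [h0])
  refine hs'.congr ?_
  filter_upwards [h] with z hz
  have : s z = 0 := by simpa using hz
  rw [this]

/-- A local section through `-f y` has sum 0 with `f` at `y`, hence nearby, so it coincides with
`-f` there. -/
theorem continuousAt_neg {Y : Type*} [TopologicalSpace Y] {π : Y → X} (hπ : Continuous π)
    {f : ∀ y, O.stalk (π y)} {y : Y}
    (hf : ContinuousAt (fun y => (⟨f y⟩ : Total O.stalk)) y) :
    ContinuousAt (fun y => (⟨-f y⟩ : Total O.stalk)) y := by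
  obtain ⟨s, U, hU, hx, h0, hs⟩ := exists_local_section (O := O) (π y) (-f y)
  have hs' : ContinuousAt (fun y => (⟨s (π y)⟩ : Total O.stalk)) y :=
    ContinuousAt.comp (f := π) (hs.continuousAt (hU.mem_nhds hx)) hπ.continuousAt
  have h := eventually_eq_of_continuousAt (continuousAt_add hf hs')
    (continuous_zero.comp hπ).continuousAt (by simp [h0])
  refine hs'.congr ?_
  filter_upwards [h] with z hz
  rw [neg_eq_of_add_eq_zero_right hz]

end Stalks

/-! ### Compact open bisections and generators with small support. -/

section Bisections

variable {X : Type u} [Groupoid.{v} X] [TopologicalSpace X] [TopologicalSpace (Arr X)]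
  [IsAmpleGroupoid X]

/-- Inversion as a homeomorphism of the arrow space. -/
def invHomeomorph : Arr X ≃ₜ Arr X where
  toFun := Arr.inv
  invFun := Arr.inv
  left_inv γ := by simp [Arr.inv]
  right_inv γ := by simp [Arr.inv]
  continuous_toFun := IsTopologicalGroupoid.continuous_inv
  continuous_invFun := IsTopologicalGroupoid.continuous_inv

theorem isLocalHomeomorph_d : IsLocalHomeomorph (Arr.d : Arr X → X) :=
  (IsEtaleGroupoid.isLocalHomeomorph_r (X := X)).comp (invHomeomorph (X := X)).isLocalHomeomorph

/-- The compact open bisections are a neighbourhood basis. -/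
theorem exists_compact_open_bisection (β : Arr X) {Ω : Set (Arr X)} (hΩ : Ω ∈ 𝓝 β) :
    ∃ W ⊆ Ω, IsCompact W ∧ IsOpen W ∧ IsBisection W ∧ β ∈ W := by
  obtain ⟨e, he, hr⟩ := IsEtaleGroupoid.isLocalHomeomorph_r (X := X) β
  obtain ⟨e', he', hd⟩ := isLocalHomeomorph_d (X := X) β
  have h1 : e.source ∩ (e'.source ∩ Ω) ∈ 𝓝 β :=
    inter_mem (e.open_source.mem_nhds he) (inter_mem (e'.open_source.mem_nhds he') hΩ)
  -- A compact open `K` inside this set lifts through the range chart `e` to a set lying in both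
  -- charts, where `r` and `d` are injective.
  have h2 : e.target ∩ e.symm ⁻¹' (e.source ∩ (e'.source ∩ Ω)) ∈ 𝓝 (e β) := by
    refine inter_mem (e.open_target.mem_nhds (e.map_source he)) ?_
    refine (e.continuousAt_symm (e.map_source he)).preimage_mem_nhds ?_
    rwa [e.left_inv he]
  obtain ⟨K, ⟨hKc, hKo⟩, hβ, hK⟩ := IsAmpleGroupoid.basis.mem_nhds_iff.1 h2
  refine ⟨e.symm '' K, ?_, ?_, ?_, ⟨?_, ?_⟩, ?_⟩
  · rintro _ ⟨y, hy, rfl⟩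
    exact (hK hy).2.2.2
  · exact hKc.image_of_continuousOn (e.continuousOn_symm.mono fun y hy => (hK hy).1)
  · exact e.symm.isOpen_image_of_subset_source hKo fun y hy => (hK hy).1
  · rintro _ ⟨y, hy, rfl⟩ _ ⟨z, hz, rfl⟩ h
    rw [hd] at h
    exact e'.injOn (hK hy).2.2.1 (hK hz).2.2.1 h
  · rintro _ ⟨y, hy, rfl⟩ _ ⟨z, hz, rfl⟩ h
    rw [hr] at h
    exact e.injOn (hK hy).2.1 (hK hz).2.1 h
  · exact ⟨e β, hβ, e.left_inv he⟩

variable {O : RingSheaf.{u, v, w} X}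

/-- There are generators with a prescribed value at an arrow and arbitrarily small support. -/
theorem exists_generator (β : Arr X) (c : O.stalk β.r) {Ω : Set (Arr X)} (hΩ : Ω ∈ 𝓝 β) :
    ∃ (f : O.Sec) (W : Set (Arr X)), W ⊆ Ω ∧ IsBisection W ∧ β ∈ W ∧ f β = c ∧
      (∀ γ, γ ∉ W → f γ = 0) ∧ IsGenerator f := by
  classical
  obtain ⟨s, U, hU, hx, h0, hs⟩ := exists_local_section (O := O) β.r c
  obtain ⟨W, hW, hc, ho, hb, hβ⟩ := exists_compact_open_bisection β
    (inter_mem hΩ ((hU.preimage continuous_r).mem_nhds hx))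
  have h1 : ∀ γ, γ ∉ W → (if γ ∈ W then s γ.r else 0) = 0 := fun γ hγ => if_neg hγ
  refine ⟨fun γ => if γ ∈ W then s γ.r else 0, W, fun γ hγ => (hW hγ).1, hb, hβ,
    (if_pos hβ).trans h0, h1, W, hc, ho, hb, ?_, h1⟩
  refine (hs.comp continuous_r.continuousOn fun γ hγ => (hW hγ).2).congr ?_
  intro γ hγ
  simp [hγ]

/-- A clopen set of units that contains a given point and lies in a given neighbourhood. -/
theorem exists_clopen {x : X} {V : Set X} (hV : V ∈ 𝓝 x) :
    ∃ C ⊆ V, IsClopen C ∧ x ∈ C := by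
  have : T2Space X := IsEtaleGroupoid.t2
  obtain ⟨K, ⟨hKc, hKo⟩, hx, hK⟩ := IsAmpleGroupoid.basis.mem_nhds_iff.1 hV
  exact ⟨K, hK, ⟨hKc.isClosed, hKo⟩, hx⟩

end Bisections

/-! ### Germs along a fibre of the range map, without the Hausdorff property. -/

section Germs

variable {X : Type u} [Groupoid.{v} X] [TopologicalSpace X] [TopologicalSpace (Arr X)]
  [IsAmpleGroupoid X] (O : RingSheaf.{u, v, w} X)

/-- The maps that vanish on the preimage under the range map of a neighbourhood of `x`. -/
def vanishingNear (x : X) : AddSubgroup O.Sec where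
  carrier := {f | ∃ V ∈ 𝓝 x, ∀ γ : Arr X, γ.r ∈ V → f γ = 0}
  zero_mem' := ⟨Set.univ, univ_mem, fun _ _ => rfl⟩
  add_mem' := by
    rintro f g ⟨V, hV, hf⟩ ⟨W, hW, hg⟩
    exact ⟨V ∩ W, inter_mem hV hW, fun γ hγ => by simp [hf γ hγ.1, hg γ hγ.2]⟩
  neg_mem' := by
    rintro f ⟨V, hV, hf⟩
    exact ⟨V, hV, fun γ hγ => by simp [hf γ hγ]⟩

/-- The maps that are continuous at `γ` and that are, over the range of a neighbourhood of `γ`,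
supported on this neighbourhood, on which the range map is injective. -/
def localizedAt (γ : Arr X) : AddSubgroup O.Sec where
  carrier := {f | ContinuousAt (fun η => (⟨f η⟩ : Total O.stalk)) γ ∧
    ∃ W : Set (Arr X), IsOpen W ∧ γ ∈ W ∧ Set.InjOn Arr.r W ∧
      ∀ η, η.r ∈ Arr.r '' W → η ∉ W → f η = 0}
  zero_mem' := by
    obtain ⟨W, -, -, ho, hb, hγ⟩ := exists_compact_open_bisection γ univ_mem
    exact ⟨(continuous_zero.comp continuous_r).continuousAt, W, ho, hγ, hb.2, fun _ _ _ => rfl⟩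
  add_mem' := by
    rintro f g ⟨hf, V, hVo, hV, hVi, hV0⟩ ⟨hg, W, hWo, hW, hWi, hW0⟩
    refine ⟨continuousAt_add hf hg, V ∩ W, hVo.inter hWo, ⟨hV, hW⟩,
      hVi.mono Set.inter_subset_left, ?_⟩
    rintro η ⟨ω, hω, hr⟩ hη
    -- An arrow of `V` with the range of `ω` equals `ω`, which also lies in `W`; so `η` avoids each
    -- set separately.
    have h1 : η ∉ V := fun h => hη (hVi h hω.1 hr.symm ▸ hω)
    have h2 : η ∉ W := fun h => hη (hWi h hω.2 hr.symm ▸ hω)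
    simp [hV0 η ⟨ω, hω.1, hr⟩ h1, hW0 η ⟨ω, hω.2, hr⟩ h2]
  neg_mem' := by
    rintro f ⟨hf, V, hVo, hV, hVi, hV0⟩
    exact ⟨continuousAt_neg continuous_r hf, V, hVo, hV, hVi, fun η h1 h2 => by
      simp [hV0 η h1 h2]⟩

variable {O}

/-- By continuity `f` is zero on a neighbourhood of `γ`. Over the range of a smaller one, every
other arrow is outside `W`, where `f` is zero anyway. -/
theorem mem_vanishingNear_of_localizedAt {γ : Arr X} {f : O.Sec} (hf : f ∈ O.localizedAt γ)
    (h0 : f γ = 0) : f ∈ O.vanishingNear γ.r := by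
  obtain ⟨hc, W, hWo, hW, hWi, hW0⟩ := hf
  have h := eventually_eq_of_continuousAt hc (continuous_zero.comp continuous_r).continuousAt h0
  obtain ⟨W', hW', hWo', hγ⟩ := eventually_nhds_iff.1 h
  refine ⟨Arr.r '' (W ∩ W'), ((IsEtaleGroupoid.isLocalHomeomorph_r (X := X)).isOpenMap _
    (hWo.inter hWo')).mem_nhds ⟨γ, ⟨hW, hγ⟩, rfl⟩, ?_⟩
  rintro η ⟨ω, hω, hr⟩
  by_cases hη : η ∈ W
  · rw [hWi hη hω.1 hr.symm]
    exact hW' ω hω.2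
  · exact hW0 η ⟨ω, hω.1, hr⟩ hη

theorem localizedAt_apply_eq_zero {γ η : Arr X} {f : O.Sec} (hf : f ∈ O.localizedAt γ)
    (hr : η.r = γ.r) (hne : η ≠ γ) : f η = 0 := by
  obtain ⟨hc, W, hWo, hW, hWi, hW0⟩ := hf
  exact hW0 η ⟨γ, hW, hr.symm⟩ fun h => hne (hWi h hW hr)

/-- The support of a generator meets `r⁻¹(x)` in at most one arrow. If there is one, the generator
is localized at it; if not, the range of the support is compact, hence closed in the Hausdorff unit
space, and misses a neighbourhood of `x`. -/
theorem sections_le_localized (x : X) :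
    O.sections ≤ O.vanishingNear x ⊔ ⨆ γ : {γ : Arr X // γ.r = x}, O.localizedAt γ.1 := by
  have : T2Space X := IsEtaleGroupoid.t2
  refine (AddSubgroup.closure_le _).2 ?_
  rintro f ⟨W, hWc, hWo, hWb, hc, h0⟩
  by_cases h : x ∈ Arr.r '' W
  · obtain ⟨γ, hγ, rfl⟩ := h
    refine AddSubgroup.mem_sup_right (AddSubgroup.mem_iSup_of_mem
      (⟨γ, rfl⟩ : {η : Arr X // η.r = γ.r}) ?_)
    exact ⟨hc.continuousAt (hWo.mem_nhds hγ), W, hWo, hγ, hWb.2, fun η _ => h0 η⟩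
  · refine AddSubgroup.mem_sup_left ⟨(Arr.r '' W)ᶜ,
      (hWc.image continuous_r).isClosed.isOpen_compl.mem_nhds h, fun η hη => h0 η ?_⟩
    exact fun h => hη ⟨η, h, rfl⟩

/-- An element of `Γ_c(𝒢, 𝒪)` that vanishes on `r⁻¹(x)` vanishes on `r⁻¹(V)` for some
neighbourhood `V` of `x`, even if the groupoid is not Hausdorff. -/
theorem mem_vanishingNear {f : O.Sec} (hf : f ∈ O.sections) {x : X}
    (h : ∀ γ : Arr X, γ.r = x → f γ = 0) : f ∈ O.vanishingNear x := by
  classical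
  obtain ⟨z, hz, g, hg, rfl⟩ := AddSubgroup.mem_sup.1 (sections_le_localized x hf)
  refine add_mem hz ?_
  have hz0 : ∀ γ : Arr X, γ.r = x → z γ = 0 := by
    obtain ⟨V, hV, hz⟩ := hz
    exact fun γ hγ => hz γ (hγ ▸ mem_of_mem_nhds hV)
  have hg0 : ∀ γ : Arr X, γ.r = x → g γ = 0 := fun γ hγ => by
    simpa [hz0 γ hγ] using h γ hγ
  -- Passing to ℤ-submodules yields a finite sum with a single term for each arrow, so generators
  -- through the same arrow are grouped before continuity is used.
  have hg' : g ∈ ⨆ γ : {γ : Arr X // γ.r = x}, (O.localizedAt γ.1).toIntSubmodule := by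
    rw [← AddSubgroup.toIntSubmodule.map_iSup]
    exact hg
  obtain ⟨c, hc, rfl⟩ := (Submodule.mem_iSup_iff_exists_finsupp _ _).1 hg'
  refine sum_mem fun γ _ => ?_
  have hγ := mem_vanishingNear_of_localizedAt (hc γ) ?_
  · rwa [γ.2] at hγ
  -- At `γ` the terms localized at other arrows over `x` vanish, so the term of `γ` is zero there by
  -- itself.
  · have h1 := hg0 γ.1 γ.2
    rw [Finsupp.sum, Finset.sum_apply, Finset.sum_eq_single γ] at h1
    · exact h1
    · intro η _ hne
      exact localizedAt_apply_eq_zero (hc η) (γ.2.trans η.2.symm)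
        fun h => hne (Subtype.ext h.symm)
    · intro hn
      rw [Finsupp.notMem_support_iff.1 hn]
      rfl

end Germs

/-! ### Stalks of a module and the first implication. -/

section Restriction

variable {X : Type u} [Groupoid.{v} X] [TopologicalSpace X] [TopologicalSpace (Arr X)]
  [IsAmpleGroupoid X] {O : RingSheaf.{u, v, w} X}

open Classical in
/-- The restriction of a map to the arrows with source in `C`. -/
noncomputable def restrict (C : Set X) (f : O.Sec) : O.Sec := fun γ => if γ.d ∈ C then f γ else 0

theorem restrict_mem {C : Set X} (hC : IsClopen C) {f : O.Sec} (hf : f ∈ O.sections) :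
    restrict C f ∈ O.sections := by
  induction hf using AddSubgroup.closure_induction with
  | mem f hf =>
    obtain ⟨W, hWc, hWo, hWb, hc, h0⟩ := hf
    refine AddSubgroup.subset_closure ⟨W ∩ Arr.d ⁻¹' C,
      hWc.inter_right (hC.1.preimage continuous_d), hWo.inter (hC.2.preimage continuous_d),
      ⟨hWb.1.mono Set.inter_subset_left, hWb.2.mono Set.inter_subset_left⟩, ?_, ?_⟩
    · refine (hc.mono Set.inter_subset_left).congr fun γ hγ => ?_
      have : restrict C f γ = f γ := if_pos hγ.2
      rw [this]
    · intro γ hγ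
      by_cases h : γ.d ∈ C
      · exact (if_pos h).trans (h0 γ fun hW => hγ ⟨hW, h⟩)
      · exact if_neg h
  | zero =>
    have : restrict C (0 : O.Sec) = 0 := by funext γ; simp [restrict]
    rw [this]; exact zero_mem _
  | add f g _ _ hf hg =>
    have : restrict C (f + g) = restrict C f + restrict C g := by
      funext γ; simp only [restrict, Pi.add_apply]; split_ifs <;> simp
    rw [this]; exact add_mem hf hg
  | neg f _ hf =>
    have : restrict C (-f) = -restrict C f := by
      funext γ; simp only [restrict, Pi.neg_apply]; split_ifs <;> simp
    rw [this]; exact neg_mem hf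

/-- Restriction as an operation on `Γ_c(𝒢, 𝒪)`. -/
noncomputable def Gamma.restrict {C : Set X} (hC : IsClopen C) (f : O.Gamma) : O.Gamma :=
  ⟨RingSheaf.restrict C f.1, restrict_mem hC f.2⟩

/-- The elements with source support in `V`. -/
def Gamma.SourceIn (f : O.Gamma) (V : Set X) : Prop := ∀ γ : Arr X, γ.d ∉ V → f.1 γ = 0

theorem conv_apply_eq_zero {f g : O.Sec} {γ : Arr X}
    (h : ∀ (y : X) (b : y ⟶ γ.r), f ⟨b⟩ = 0 ∨ g ⟨γ.hom ≫ Groupoid.inv b⟩ = 0) :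
    conv f g γ = 0 := by
  unfold conv
  rw [← finsum_zero (α := Σ y : X, (y ⟶ γ.r))]
  refine finsum_congr ?_
  rintro ⟨y, b⟩
  rcases h y b with h | h <;> simp [h]

/-- In each factorization `βρ` the source of `β` is the range of `ρ`, so one of the two factors
vanishes. -/
theorem Gamma.mul_eq_zero {f g : O.Gamma} {V : Set X} (hf : f.SourceIn V)
    (hg : ∀ γ : Arr X, γ.r ∈ V → g.1 γ = 0) : f * g = 0 := by
  refine Subtype.ext <| funext fun γ => conv_apply_eq_zero fun y b => ?_
  by_cases hy : y ∈ V
  · exact Or.inr (hg _ hy)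
  · exact Or.inl (hf _ hy)

section Module

variable {M : Type*} [AddCommGroup M] (ρ : O.Gamma →ₙ+* AddMonoid.End M)

/-- The elements of a module whose image in the stalk at `x` of the associated sheaf of modules
is zero. -/
def stalkKernel (x : X) : AddSubgroup M where
  carrier := {m | ∃ V ∈ 𝓝 x, ∀ g : O.Gamma, g.SourceIn V → ρ g m = 0}
  zero_mem' := ⟨Set.univ, univ_mem, fun g _ => (ρ g).map_zero⟩
  add_mem' := by
    rintro m n ⟨V, hV, hm⟩ ⟨W, hW, hn⟩
    refine ⟨V ∩ W, inter_mem hV hW, fun g hg => ?_⟩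
    rw [map_add, hm g fun γ h => hg γ fun h' => h h'.1, hn g fun γ h => hg γ fun h' => h h'.2,
      add_zero]
  neg_mem' := by
    rintro m ⟨V, hV, hm⟩
    exact ⟨V, hV, fun g hg => by rw [map_neg, hm g hg, neg_zero]⟩

/-- An element that vanishes in all stalks is annihilated by the ring. -/
theorem map_eq_zero_of_mem_stalkKernel {m : M} (hm : ∀ x, m ∈ stalkKernel ρ x) (f : O.Gamma) :
    ρ f m = 0 := by
  have : T2Space X := IsEtaleGroupoid.t2
  have hadd : ∀ a b : O.Gamma, ρ (a + b) m = ρ a m + ρ b m := fun a b => by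
    rw [map_add]; rfl
  have hneg : ∀ a : O.Gamma, ρ (-a) m = -ρ a m := fun a => by
    rw [map_neg]; rfl
  have hgen : ∀ f : O.Sec, ∀ hf : IsGenerator f,
      ρ ⟨f, AddSubgroup.subset_closure hf⟩ m = 0 := by
    intro f hf
    obtain ⟨W, hWc, hWo, hWb, hc, h0⟩ := id hf
    set F : O.Gamma := ⟨f, AddSubgroup.subset_closure hf⟩
    -- Compactness of `d(W)` glues the local annihilation. Demanding it for every clopen subset of
    -- `C` is what lets it pass to unions.
    have key : ∃ C : Set X, IsClopen C ∧ Arr.d '' W ⊆ C ∧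
        ∀ C', ∀ hC' : IsClopen C', C' ⊆ C → ρ (F.restrict hC') m = 0 := by
      refine (hWc.image continuous_d).induction_on (p := fun S => ∃ C : Set X, IsClopen C ∧ S ⊆ C ∧
        ∀ C', ∀ hC' : IsClopen C', C' ⊆ C → ρ (F.restrict hC') m = 0) ?_ ?_ ?_ ?_
      · refine ⟨∅, isClopen_empty, subset_rfl, fun C' hC' h => ?_⟩
        have : F.restrict hC' = 0 := Subtype.ext <| funext fun γ => if_neg fun h' => h h'
        rw [this, map_zero]; rfl
      · rintro S T hST ⟨C, hC, hT, h⟩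
        exact ⟨C, hC, hST.trans hT, h⟩
      · rintro S T ⟨C, hC, hS, h⟩ ⟨D, hD, hT, h'⟩
        refine ⟨C ∪ D, hC.union hD, Set.union_subset_union hS hT, fun C' hC' hsub => ?_⟩
        -- The two pieces are disjoint; the second lies in `D` because `C'` lies in `C ∪ D`.
        have hsum : F.restrict hC' =
            F.restrict (hC'.inter hC) + F.restrict (hC'.diff hC) := by
          refine Subtype.ext <| funext fun γ => ?_
          change RingSheaf.restrict _ f γ = RingSheaf.restrict _ f γ + RingSheaf.restrict _ f γ
          by_cases h1 : γ.d ∈ C' <;> by_cases h2 : γ.d ∈ C <;> simp [RingSheaf.restrict, h1, h2]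
        rw [hsum, hadd, h _ _ Set.inter_subset_right,
          h' _ _ fun y hy => (hsub hy.1).resolve_left hy.2, add_zero]
      · intro x _
        obtain ⟨V, hV, hmV⟩ := hm x
        obtain ⟨C, hCV, hC, hx⟩ := exists_clopen hV
        refine ⟨C, mem_nhdsWithin_of_mem_nhds (hC.2.mem_nhds hx), C, hC, subset_rfl,
          fun C' hC' hsub => hmV _ fun γ hγ => if_neg fun h => hγ (hCV (hsub h))⟩
    obtain ⟨C, hC, hWC, h⟩ := key
    have hF : F.restrict hC = F := by
      refine Subtype.ext <| funext fun γ => ?_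
      by_cases h1 : γ.d ∈ C
      · exact if_pos h1
      · exact (if_neg h1).trans (h0 γ fun hγ => h1 (hWC ⟨γ, hγ, rfl⟩)).symm
    rw [← hF]
    exact h C hC subset_rfl
  obtain ⟨f, hf⟩ := f
  induction hf using AddSubgroup.closure_induction with
  | mem f hf => exact hgen f hf
  | zero =>
    change ρ (0 : O.Gamma) m = 0
    rw [map_zero]; rfl
  | add f g hf hg h1 h2 =>
    exact (hadd ⟨f, hf⟩ ⟨g, hg⟩).trans (by rw [h1, h2, add_zero])
  | neg f hf h1 => exact (hneg ⟨f, hf⟩).trans (by rw [h1, neg_zero])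

/-- Vanishing on `r⁻¹(x)` spreads to some `r⁻¹(V)`, and then `g * f = 0` whenever `g` has its
sources in `V`. -/
theorem map_mem_stalkKernel {f : O.Gamma} {x : X} (hf : ∀ γ : Arr X, γ.r = x → f.1 γ = 0)
    (m : M) : ρ f m ∈ stalkKernel ρ x := by
  obtain ⟨V, hV, h⟩ := mem_vanishingNear f.2 hf
  refine ⟨V, hV, fun g hg => ?_⟩
  have h1 : ρ g (ρ f m) = ρ (g * f) m := by rw [map_mul]; rfl
  rw [h1, Gamma.mul_eq_zero hg h, map_zero]
  rfl

end Module

/-- If the convolution ring is left primitive, then the restriction to some orbit is injective. -/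
theorem exists_orbit_of_isLeftPrimitive (h : IsLeftPrimitive O.Gamma) :
    ∃ x : X, ∀ f : O.Gamma, (∀ γ : Arr X, γ.d ∈ Orb x → f.1 γ = 0) → f = 0 := by
  obtain ⟨M, _, ρ, hinj, ⟨r, m, hrm⟩, hsimple⟩ := h
  obtain ⟨x, hx⟩ : ∃ x, m ∉ stalkKernel ρ x := by
    by_contra! hall
    exact hrm (map_eq_zero_of_mem_stalkKernel ρ hall r)
  refine ⟨x, fun f hf => hinj ?_⟩
  let J : AddSubgroup M := AddSubgroup.closure
    {n | ∃ (f : O.Gamma) (k : M), (∀ γ : Arr X, γ.d ∈ Orb x → f.1 γ = 0) ∧ ρ f k = n}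
  have hJ : ∀ r, ∀ n ∈ J, ρ r n ∈ J := by
    intro r n hn
    induction hn using AddSubgroup.closure_induction with
    | mem n hn =>
      obtain ⟨g, k, hg, rfl⟩ := hn
      refine AddSubgroup.subset_closure ⟨r * g, k, fun γ hγ => ?_, by rw [map_mul]; rfl⟩
      -- In `γ = βρ` the arrow `ρ` has the source of `γ`, so these elements form a left ideal.
      exact conv_apply_eq_zero fun y b => Or.inr (hg _ hγ)
    | zero => rw [map_zero]; exact zero_mem _
    | add a b _ _ ha hb => rw [map_add]; exact add_mem ha hb
    | neg a _ ha => rw [map_neg]; exact neg_mem ha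
  have hle : J ≤ stalkKernel ρ x := by
    refine (AddSubgroup.closure_le _).2 ?_
    rintro _ ⟨g, k, hg, rfl⟩
    refine map_mem_stalkKernel ρ (fun γ hγ => hg γ ?_) k
    subst hγ
    -- The inverse of an arrow ending at `x` shows that its source lies in the orbit.
    exact ⟨γ.inv, rfl, rfl⟩
  rcases hsimple J hJ with h | h
  · rw [map_zero]
    ext k
    have : ρ f k ∈ J := AddSubgroup.subset_closure ⟨f, k, hf, rfl⟩
    rw [h] at this
    exact this
  · exact absurd (hle (h ▸ AddSubgroup.mem_top m)) hx

end Restriction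

/-! ### The induced module over the convolution ring. -/

section Induction

variable {X : Type u} [Groupoid.{v} X] [TopologicalSpace X] [TopologicalSpace (Arr X)]

/-- The set `d⁻¹(x)` of arrows with source `x`. -/
abbrev Star (x : X) : Type (max u v) := Σ y : X, (x ⟶ y)

/-- Right multiplication by an element of the isotropy group. -/
def Star.mulRight {x : X} (δ : End x) : Star x ≃ Star x where
  toFun γ := ⟨γ.1, (δ : x ⟶ x) ≫ γ.2⟩
  invFun γ := ⟨γ.1, Groupoid.inv (δ : x ⟶ x) ≫ γ.2⟩
  left_inv γ := by simp
  right_inv γ := by simp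

section Kernel

variable {O : RingSheaf.{u, v, w} X} {x : X}

/-- The matrix, indexed by `d⁻¹(x)` and with entries in the stalk at `x`, by which `f` acts on
the left. -/
def kernel (f : O.Sec) (γ η : Star x) : O.stalk x :=
  O.act (Groupoid.inv γ.2) (f ⟨Groupoid.inv η.2 ≫ γ.2⟩)

theorem act_inv_act {y z : X} (γ : y ⟶ z) (a : O.stalk y) :
    O.act (Groupoid.inv γ) (O.act γ a) = a := by
  rw [← O.act_comp, Groupoid.comp_inv, O.act_id]

theorem act_act_inv {y z : X} (γ : y ⟶ z) (a : O.stalk z) :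
    O.act γ (O.act (Groupoid.inv γ) a) = a := by
  rw [← O.act_comp, Groupoid.inv_comp, O.act_id]

/-- Left division by `γ`. -/
def Star.quotEquiv (γ : Star x) : Star x ≃ Σ y : X, (y ⟶ γ.1) where
  toFun η := ⟨η.1, Groupoid.inv η.2 ≫ γ.2⟩
  invFun b := ⟨b.1, γ.2 ≫ Groupoid.inv b.2⟩
  left_inv η := by simp [Groupoid.inv_eq_inv]
  right_inv b := by simp [Groupoid.inv_eq_inv]

theorem finite_support_kernel {f : O.Sec} (hf : f ∈ O.sections) (γ : Star x) :
    (Function.support (kernel f γ)).Finite := by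
  refine ((finite_fiber hf γ.1).preimage (Star.quotEquiv γ).injective.injOn).subset ?_
  intro η hη h0
  apply hη
  change O.act _ (f ⟨((Star.quotEquiv γ) η).2⟩) = 0
  rw [h0, map_zero]

/-- Factorizations of `γη⁻¹` are the products `(γζ⁻¹)(ζη⁻¹)` with `ζ` in `d⁻¹(x)`, and `α_{γ⁻¹}
α_{γζ⁻¹} = α_{ζ⁻¹}` gives the second entry. -/
theorem kernel_conv {f : O.Sec} (hf : f ∈ O.sections) (g : O.Sec) (γ η : Star x) :
    kernel (conv f g) γ η = ∑ᶠ ζ, kernel f γ ζ * kernel g ζ η := by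
  unfold kernel conv
  have h := (O.act (Groupoid.inv γ.2)).toAddMonoidHom.map_finsum
    (finite_conv_support hf g ⟨Groupoid.inv η.2 ≫ γ.2⟩)
  refine h.trans ?_
  rw [← finsum_comp_equiv (Star.quotEquiv γ)]
  refine finsum_congr fun ζ => ?_
  change O.act (Groupoid.inv γ.2) (f ⟨Groupoid.inv ζ.2 ≫ γ.2⟩ *
    O.act (Groupoid.inv ζ.2 ≫ γ.2)
      (g ⟨(Groupoid.inv η.2 ≫ γ.2) ≫ Groupoid.inv (Groupoid.inv ζ.2 ≫ γ.2)⟩)) = _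
  have h1 : (Groupoid.inv η.2 ≫ γ.2) ≫ Groupoid.inv (Groupoid.inv ζ.2 ≫ γ.2) =
      Groupoid.inv η.2 ≫ ζ.2 := by simp [Groupoid.inv_eq_inv]
  rw [h1, map_mul, O.act_comp, act_inv_act]

/-- The rows of the kernel. -/
noncomputable def kernelRow {f : O.Sec} (hf : f ∈ O.sections) (γ : Star x) :
    Star x →₀ O.stalk x :=
  Finsupp.ofSupportFinite (kernel f γ) (finite_support_kernel hf γ)

theorem kernelRow_apply {f : O.Sec} (hf : f ∈ O.sections) (γ η : Star x) :
    kernelRow hf γ η = kernel f γ η := rfl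

theorem kernelRow_add {f g : O.Sec} (hf : f ∈ O.sections) (hg : g ∈ O.sections) (γ : Star x) :
    kernelRow (add_mem hf hg) γ = kernelRow hf γ + kernelRow hg γ := by
  ext η
  simp [kernelRow_apply, kernel]

theorem kernelRow_zero (γ : Star x) : kernelRow (zero_mem O.sections) γ = 0 := by
  ext η
  simp [kernelRow_apply, kernel]

theorem kernelRow_conv [IsAmpleGroupoid X] {f g : O.Sec} (hf : f ∈ O.sections)
    (hg : g ∈ O.sections) (γ : Star x) :
    kernelRow (conv_mem hf hg) γ =
      Finsupp.linearCombination (O.stalk x) (kernelRow hg) (kernelRow hf γ) := by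
  ext η
  rw [Finsupp.linearCombination_apply, Finsupp.sum, Finsupp.finsetSum_apply, kernelRow_apply,
    kernel_conv hf]
  refine finsum_eq_sum_of_support_subset _ fun ζ hζ => ?_
  rw [Finset.mem_coe, Finsupp.mem_support_iff]
  intro h0
  apply hζ
  change kernelRow hf γ ζ * _ = 0
  rw [h0, zero_mul]

/-- Since `(γδ)(ηδ)⁻¹ = γη⁻¹`, only the outer twist changes, by `δ⁻¹`. -/
theorem kernel_mulRight (f : O.Sec) (δ : End x) (γ η : Star x) :
    kernel f (Star.mulRight δ γ) (Star.mulRight δ η) = δ⁻¹ • kernel f γ η := by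
  change O.act (Groupoid.inv (_ ≫ γ.2)) (f ⟨Groupoid.inv (_ ≫ η.2) ≫ _ ≫ γ.2⟩) =
    O.act (Groupoid.inv (δ : x ⟶ x)) (O.act (Groupoid.inv γ.2) (f ⟨Groupoid.inv η.2 ≫ γ.2⟩))
  rw [← O.act_comp]
  have h1 : Groupoid.inv ((δ : x ⟶ x) ≫ γ.2) = Groupoid.inv γ.2 ≫ Groupoid.inv (δ : x ⟶ x) := by
    simp [Groupoid.inv_eq_inv]
  have h2 : Groupoid.inv ((δ : x ⟶ x) ≫ η.2) ≫ (δ : x ⟶ x) ≫ γ.2 = Groupoid.inv η.2 ≫ γ.2 := by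
    simp [Groupoid.inv_eq_inv]
  rw [h1, h2]

/-- Elements of `Γ_c(𝒢, 𝒪)` have finite support on the arrows with a given source. -/
theorem finite_ranges {f : O.Sec} (hf : f ∈ O.sections) (y : X) :
    {z : X | ∃ γ : y ⟶ z, f ⟨γ⟩ ≠ 0}.Finite := by
  induction hf using AddSubgroup.closure_induction with
  | mem f hf =>
    obtain ⟨U, -, -, hU, hs⟩ := hf
    apply Set.Subsingleton.finite
    rintro z ⟨b, hb⟩ z' ⟨c, hc⟩
    have h1 : (⟨b⟩ : Arr X) ∈ U := by by_contra h; exact hb (hs.2 _ h)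
    have h2 : (⟨c⟩ : Arr X) ∈ U := by by_contra h; exact hc (hs.2 _ h)
    exact congrArg Arr.r (hU.1 h1 h2 rfl)
  | zero => simp
  | add f g _ _ hf hg =>
    refine (hf.union hg).subset ?_
    rintro z ⟨γ, hγ⟩
    by_contra h
    simp only [Set.mem_union, Set.mem_ofPred_eq, not_or, not_exists, not_not] at h
    exact hγ (by simp [h.1, h.2])
  | neg f _ hf => simpa using hf

end Kernel

/-! ### Equivariant maps, simplicity and faithfulness. -/

section Induced

variable (O : RingSheaf.{u, v, w} X) (x : X)

/-- The induced module of a module `V` over the isotropy skew group ring: the equivariant maps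
`d⁻¹(x) → V` that vanish on all but finitely many fibres of the range map. -/
def induced (V : Type*) [AddCommGroup V] [DistribMulAction (End x) V] :
    AddSubgroup (Star x → V) where
  carrier := {φ | (∀ (δ : End x) (γ : Star x), φ (Star.mulRight δ γ) = δ⁻¹ • φ γ) ∧
    {y : X | ∃ γ : x ⟶ y, φ ⟨y, γ⟩ ≠ 0}.Finite}
  zero_mem' := by simp
  add_mem' := by
    rintro φ ψ ⟨h1, h2⟩ ⟨h3, h4⟩
    refine ⟨fun δ γ => by simp [h1, h3], (h2.union h4).subset ?_⟩
    rintro y ⟨γ, hγ⟩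
    by_contra h
    simp only [Set.mem_union, Set.mem_ofPred_eq, not_or, not_exists, not_not] at h
    exact hγ (by simp [h.1, h.2])
  neg_mem' := by
    rintro φ ⟨h1, h2⟩
    exact ⟨fun δ γ => by simp [h1], by simpa using h2⟩

variable {O x} {V : Type*} [AddCommGroup V] [DistribMulAction (End x) V]

/-- The isotropy group acts transitively on the arrows from `x` to `y`, so one value determines an
equivariant map on the whole fibre. -/
theorem eq_smul_of_mem_induced {φ : Star x → V} (hφ : φ ∈ induced x V) {y : X} (γ η : x ⟶ y) :
    φ ⟨y, η⟩ = (End.of (γ ≫ Groupoid.inv η)) • φ ⟨y, γ⟩ := by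
  have h := hφ.1 (End.of (η ≫ Groupoid.inv γ)) ⟨y, γ⟩
  have h1 : Star.mulRight (End.of (η ≫ Groupoid.inv γ)) ⟨y, γ⟩ = (⟨y, η⟩ : Star x) := by
    change (⟨y, (η ≫ Groupoid.inv γ) ≫ γ⟩ : Star x) = _
    simp
  have h2 : (End.of (η ≫ Groupoid.inv γ))⁻¹ = (End.of (γ ≫ Groupoid.inv η)) := by
    change Groupoid.inv (η ≫ Groupoid.inv γ) = _
    simp [Groupoid.inv_eq_inv]
  rwa [h1, h2] at h

/-- Two equivariant maps that vanish outside the fibre of `γ` are equal if they agree at `γ`. -/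
theorem eq_of_mem_induced {φ ψ : Star x → V} (hφ : φ ∈ induced x V) (hψ : ψ ∈ induced x V)
    (γ : Star x) (h : φ γ = ψ γ) (h1 : ∀ η : Star x, η.1 ≠ γ.1 → φ η = 0)
    (h2 : ∀ η : Star x, η.1 ≠ γ.1 → ψ η = 0) : φ = ψ := by
  funext η
  by_cases hη : η.1 = γ.1
  · obtain ⟨y, γ⟩ := γ
    obtain ⟨z, η⟩ := η
    obtain rfl : z = y := hη
    rw [eq_smul_of_mem_induced hφ γ η, eq_smul_of_mem_induced hψ γ η, h]
  · rw [h1 η hη, h2 η hη]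

open Classical in
/-- The equivariant map with value `v` at `γ` that vanishes outside the fibre of `γ`. -/
noncomputable def bump (γ : Star x) : V →+ Star x → V where
  toFun v η := if h : γ.1 = η.1 then End.of (γ.2 ≫ eqToHom h ≫ Groupoid.inv η.2) • v else 0
  map_zero' := by funext η; simp
  map_add' v w := by
    funext η
    simp only [Pi.add_apply]
    split_ifs <;> simp

theorem bump_apply {y : X} (γ η : x ⟶ y) (v : V) :
    bump ⟨y, γ⟩ v ⟨y, η⟩ = (End.of (γ ≫ Groupoid.inv η)) • v := by
  simp [bump]

theorem bump_apply_self (γ : Star x) (v : V) : bump γ v γ = v := by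
  rw [bump_apply, Groupoid.comp_inv]
  exact one_smul (End x) v

theorem bump_apply_of_ne {γ η : Star x} (h : η.1 ≠ γ.1) (v : V) : bump γ v η = 0 :=
  dif_neg (Ne.symm h)

theorem bump_mem (γ : Star x) (v : V) : bump γ v ∈ induced x V := by
  refine ⟨fun δ η => ?_, (Set.finite_singleton γ.1).subset ?_⟩
  · by_cases h : η.1 = γ.1
    · obtain ⟨y, γ⟩ := γ
      obtain ⟨z, η⟩ := η
      obtain rfl : z = y := h
      have h1 : Star.mulRight δ (⟨z, η⟩ : Star x) = ⟨z, (δ : x ⟶ x) ≫ η⟩ := rfl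
      rw [h1, bump_apply, bump_apply, smul_smul]
      congr 1
      change _ = (γ ≫ Groupoid.inv η) ≫ Groupoid.inv (δ : x ⟶ x)
      simp [Groupoid.inv_eq_inv]
    · rw [bump_apply_of_ne h, bump_apply_of_ne (η := Star.mulRight δ η) h, smul_zero]
  · rintro y ⟨η, hη⟩
    by_contra h
    exact hη (bump_apply_of_ne (η := ⟨y, η⟩) h v)

variable [Module (O.stalk x) V]

/-- The action of `Γ_c(𝒢, 𝒪)` on the maps `d⁻¹(x) → V`. -/
noncomputable def kernelAct {f : O.Sec} (hf : f ∈ O.sections) (φ : Star x → V) : Star x → V :=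
  fun γ => Finsupp.linearCombination (O.stalk x) φ (kernelRow hf γ)

theorem kernelAct_apply {f : O.Sec} (hf : f ∈ O.sections) (φ : Star x → V) (γ : Star x) :
    kernelAct hf φ γ = ∑ᶠ η, kernel f γ η • φ η := by
  unfold kernelAct
  rw [Finsupp.linearCombination_apply, Finsupp.sum]
  refine (finsum_eq_sum_of_support_subset _ fun η hη => ?_).symm
  rw [Finset.mem_coe, Finsupp.mem_support_iff]
  intro h0
  apply hη
  change kernelRow hf γ η • _ = 0
  rw [h0, zero_smul]

theorem kernelAct_add_left {f g : O.Sec} (hf : f ∈ O.sections) (hg : g ∈ O.sections)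
    (φ : Star x → V) : kernelAct (add_mem hf hg) φ = kernelAct hf φ + kernelAct hg φ := by
  funext γ
  simp only [kernelAct, kernelRow_add hf hg, map_add, Pi.add_apply]

theorem kernelAct_zero_left (φ : Star x → V) : kernelAct (zero_mem O.sections) φ = 0 := by
  funext γ
  simp only [kernelAct, kernelRow_zero, map_zero, Pi.zero_apply]

theorem kernelAct_add {f : O.Sec} (hf : f ∈ O.sections) (φ ψ : Star x → V) :
    kernelAct hf (φ + ψ) = kernelAct hf φ + kernelAct hf ψ := by
  funext γ
  simp [kernelAct, Finsupp.linearCombination_apply, Finsupp.sum_add]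

theorem kernelAct_zero {f : O.Sec} (hf : f ∈ O.sections) :
    kernelAct hf (0 : Star x → V) = 0 := by
  funext γ
  simp [kernelAct]

theorem kernelAct_conv [IsAmpleGroupoid X] {f g : O.Sec} (hf : f ∈ O.sections)
    (hg : g ∈ O.sections) (φ : Star x → V) :
    kernelAct (conv_mem hf hg) φ = kernelAct hf (kernelAct hg φ) := by
  funext γ
  unfold kernelAct
  rw [kernelRow_conv hf hg, Finsupp.apply_linearCombination]
  rfl

theorem exists_of_kernelAct_ne_zero {f : O.Sec} (hf : f ∈ O.sections) {φ : Star x → V}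
    {γ : Star x} (h : kernelAct hf φ γ ≠ 0) :
    ∃ η : Star x, f ⟨Groupoid.inv η.2 ≫ γ.2⟩ ≠ 0 ∧ φ η ≠ 0 := by
  by_contra! hall
  apply h
  rw [kernelAct_apply, ← finsum_zero (α := Star x)]
  refine finsum_congr fun η => ?_
  by_cases h0 : f ⟨Groupoid.inv η.2 ≫ γ.2⟩ = 0
  · simp [kernel, h0]
  · rw [hall η h0, smul_zero]

variable [SMulDistribClass (End x) (O.stalk x) V]

/-- Equivariance comes from the substitution `η ↦ ηδ`. For finiteness, `φ` lives over finitely many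
`y`, and from each `y` the support of `f` reaches finitely many ranges. -/
theorem kernelAct_mem {f : O.Sec} (hf : f ∈ O.sections) {φ : Star x → V}
    (hφ : φ ∈ induced x V) : kernelAct hf φ ∈ induced x V := by
  refine ⟨fun δ γ => ?_, ?_⟩
  · rw [kernelAct_apply, kernelAct_apply, ← finsum_comp_equiv (Star.mulRight δ)]
    have hfin : (Function.support fun η => kernel f γ η • φ η).Finite :=
      (finite_support_kernel hf γ).subset fun η hη h0 => hη (by simp [h0])
    refine Eq.trans ?_ ((DistribSMul.toAddMonoidHom V δ⁻¹).map_finsum hfin).symm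
    refine finsum_congr fun η => ?_
    rw [kernel_mulRight, hφ.1]
    exact (smul_distrib_smul _ _ _).symm
  · refine (hφ.2.biUnion fun y _ => finite_ranges hf y).subset ?_
    rintro z ⟨γ, hγ⟩
    obtain ⟨η, h1, h2⟩ := exists_of_kernelAct_ne_zero hf hγ
    exact Set.mem_biUnion (x := η.1) ⟨η.2, h2⟩ ⟨_, h1⟩

variable [IsAmpleGroupoid X]

variable (O x V) in
/-- The induced module as a module over `Γ_c(𝒢, 𝒪)`. -/
noncomputable def inducedRep : O.Gamma →ₙ+* AddMonoid.End (induced x V) where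
  toFun f :=
    { toFun := fun φ => ⟨kernelAct f.2 φ.1, kernelAct_mem f.2 φ.2⟩
      map_zero' := Subtype.ext (kernelAct_zero f.2)
      map_add' := fun φ ψ => Subtype.ext (kernelAct_add f.2 φ.1 ψ.1) }
  map_mul' f g := AddMonoidHom.ext fun φ => Subtype.ext (kernelAct_conv f.2 g.2 φ.1)
  map_zero' := AddMonoidHom.ext fun φ => Subtype.ext (kernelAct_zero_left φ.1)
  map_add' f g := AddMonoidHom.ext fun φ => Subtype.ext (kernelAct_add_left f.2 g.2 φ.1)

/-- Any value of an equivariant map can be moved by generators to any arrow, up to the action of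
the isotropy skew group ring. -/
theorem exists_inducedRep_eq_bump (φ : induced x V) (γ₀ γ₁ : Star x) (a : O.stalk x)
    (δ : End x) :
    ∃ f : O.Gamma, (inducedRep O x V f φ).1 = bump γ₁ (a • δ • φ.1 γ₀) := by
  have : T2Space X := IsEtaleGroupoid.t2
  -- This is `γ₁δγ₀⁻¹`. The finite set `F` of the other fibres supporting `φ` is closed, so a
  -- bisection through `β` can avoid it on the source side.
  let β : γ₀.1 ⟶ γ₁.1 := Groupoid.inv γ₀.2 ≫ (δ : x ⟶ x) ≫ γ₁.2
  let F : Set X := {y : X | ∃ γ : x ⟶ y, φ.1 ⟨y, γ⟩ ≠ 0} \ {γ₀.1}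
  have hF : IsOpen Fᶜ := (φ.2.2.subset Set.sdiff_subset).isClosed.isOpen_compl
  obtain ⟨f, W, hWF, hWb, hβ, hfβ, hf0, hf⟩ := exists_generator (O := O) (⟨β⟩ : Arr X)
    (O.act γ₁.2 a) ((hF.preimage continuous_d).mem_nhds fun h => h.2 rfl)
  have hfs : f ∈ O.sections := AddSubgroup.subset_closure hf
  have key : ∀ η ζ : Star x, f ⟨Groupoid.inv ζ.2 ≫ η.2⟩ ≠ 0 → φ.1 ζ ≠ 0 →
      (⟨Groupoid.inv ζ.2 ≫ η.2⟩ : Arr X) = ⟨β⟩ := by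
    intro η ζ h1 h2
    have hW : (⟨Groupoid.inv ζ.2 ≫ η.2⟩ : Arr X) ∈ W := by
      by_contra h
      exact h1 (hf0 _ h)
    refine hWb.1 hW hβ ?_
    by_contra hne
    exact hWF hW ⟨⟨ζ.2, h2⟩, hne⟩
  refine ⟨⟨f, hfs⟩, ?_⟩
  change kernelAct hfs φ.1 = _
  refine eq_of_mem_induced (kernelAct_mem hfs φ.2) (bump_mem _ _) γ₁ ?_ ?_
    fun η hη => bump_apply_of_ne hη _
  · rw [bump_apply_self, kernelAct_apply,
      -- The only contributing index is `γ₀δ⁻¹`, where `φ` has the value `δ • φ(γ₀)` and the matrix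
      -- entry is `a`.
      finsum_eq_single _ (⟨γ₀.1, Groupoid.inv (δ : x ⟶ x) ≫ γ₀.2⟩ : Star x)]
    · have h1 : Groupoid.inv (Groupoid.inv (δ : x ⟶ x) ≫ γ₀.2) ≫ γ₁.2 = β := by
        simp [β, Groupoid.inv_eq_inv]
      have h2 : kernel f γ₁ (⟨γ₀.1, Groupoid.inv (δ : x ⟶ x) ≫ γ₀.2⟩ : Star x) = a := by
        unfold kernel
        dsimp only
        rw [h1, hfβ, act_inv_act]
      have h3 := φ.2.1 δ⁻¹ γ₀
      rw [inv_inv] at h3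
      rw [h2, ← h3]
      rfl
    · intro ζ hζ
      by_contra hne
      have h1 : f ⟨Groupoid.inv ζ.2 ≫ γ₁.2⟩ ≠ 0 := fun h => hne (by simp [kernel, h])
      have h2 : φ.1 ζ ≠ 0 := fun h => hne (by simp [h])
      obtain ⟨y, ζ⟩ := ζ
      have h3 := key γ₁ ⟨y, ζ⟩ h1 h2
      apply hζ
      injection h3 with h4 _ h5
      dsimp only at h4
      subst h4
      have h6 := eq_of_heq h5
      have h7 : ζ = γ₁.2 ≫ Groupoid.inv (Groupoid.inv ζ ≫ γ₁.2) := by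
        simp [Groupoid.inv_eq_inv]
      dsimp only at h6
      rw [h7, h6]
      simp [β, Groupoid.inv_eq_inv]
  · intro η hη
    by_contra hne
    obtain ⟨ζ, h1, h2⟩ := exists_of_kernelAct_ne_zero hfs hne
    exact hη (congrArg Arr.r (key η ζ h1 h2))

/-- The induced module of a simple module has no proper nonzero submodules. -/
theorem inducedRep_simple
    (hV : ∀ v : V, v ≠ 0 → ∀ P : AddSubgroup V,
      (∀ (a : O.stalk x) (δ : End x), a • δ • v ∈ P) → P = ⊤)
    (N : AddSubgroup (induced x V)) (hN : ∀ f, ∀ φ ∈ N, inducedRep O x V f φ ∈ N) :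
    N = ⊥ ∨ N = ⊤ := by
  rw [or_iff_not_imp_left]
  intro hbot
  obtain ⟨φ, hφ, hne⟩ := (AddSubgroup.bot_or_exists_ne_zero N).resolve_left hbot
  obtain ⟨γ₀, hγ₀⟩ : ∃ γ₀, φ.1 γ₀ ≠ 0 := by
    by_contra! h
    exact hne (Subtype.ext (funext h))
  have hbump : ∀ γ (v : V), (⟨bump γ v, bump_mem γ v⟩ : induced x V) ∈ N := by
    intro γ v
    let P : AddSubgroup V := N.comap
      { toFun := fun v => (⟨bump γ v, bump_mem γ v⟩ : induced x V)
        map_zero' := Subtype.ext (map_zero (bump γ))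
        map_add' := fun v w => Subtype.ext (map_add (bump γ) v w) }
    have hP : P = ⊤ := by
      refine hV _ hγ₀ P fun a δ => ?_
      obtain ⟨f, hf⟩ := exists_inducedRep_eq_bump φ γ₀ γ a δ
      have h1 := hN f _ hφ
      have h2 : inducedRep O x V f φ = ⟨bump γ (a • δ • φ.1 γ₀), bump_mem _ _⟩ :=
        Subtype.ext hf
      rw [h2] at h1
      exact h1
    have : v ∈ P := hP ▸ AddSubgroup.mem_top v
    exact this
  -- The bumps generate: subtracting a bump with the right value clears one fibre at a time.
  have hall : ∀ (F : Set X), F.Finite → ∀ ψ : induced x V,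
      (∀ γ, ψ.1 γ ≠ 0 → γ.1 ∈ F) → ψ ∈ N := by
    intro F hF
    induction F, hF using Set.Finite.induction_on with
    | empty =>
      intro ψ hψ
      have : ψ = 0 := Subtype.ext <| funext fun γ => by
        by_contra h
        exact hψ γ h
      rw [this]
      exact zero_mem N
    | @insert z F _ _ ih =>
      intro ψ hψ
      by_cases hz : Nonempty (x ⟶ z)
      · obtain ⟨γ⟩ := hz
        let χ : induced x V := ⟨bump ⟨z, γ⟩ (ψ.1 ⟨z, γ⟩), bump_mem _ _⟩
        rw [← sub_add_cancel ψ χ]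
        refine add_mem (ih _ fun η hη => ?_) (hbump _ _)
        change ψ.1 η - bump _ _ η ≠ 0 at hη
        by_cases h : η.1 = z
        · obtain ⟨y, η⟩ := η
          obtain rfl : y = z := h
          refine absurd ?_ hη
          rw [bump_apply, ← eq_smul_of_mem_induced ψ.2, sub_self]
        · rw [bump_apply_of_ne h, sub_zero] at hη
          exact (hψ η hη).resolve_left h
      · refine ih ψ fun η hη => (hψ η hη).resolve_left ?_
        rintro rfl
        exact hz ⟨η.2⟩
  rw [eq_top_iff]
  exact fun ψ _ => hall _ ψ.2.2 ψ fun γ hγ => ⟨γ.2, hγ⟩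

/-- An element that annihilates the induced module of a faithful module vanishes over the
orbit. -/
theorem apply_eq_zero_of_inducedRep_eq_zero
    (hV : ∀ b : End x →₀ O.stalk x, (∀ v : V, b.sum (fun δ a => a • δ • v) = 0) → b = 0)
    {f : O.Gamma} (hf : inducedRep O x V f = 0) (β : Arr X) (hβ : β.d ∈ Orb x) : f.1 β = 0 := by
  obtain @⟨y, z, β⟩ := β
  obtain ⟨@⟨x, y, γ₀⟩, hx, hy⟩ := hβ
  dsimp only at hx hy
  subst hx hy
  let γ : Star x := ⟨z, γ₀ ≫ β⟩
  -- These are the arrows `γ₀δ⁻¹` of the fibre over `y`. The bump at `γ₀` takes the value `δ • v`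
  -- there, so `b` collects the coefficients of a skew group ring element.
  let j : End x → Star x := fun δ => ⟨y, Groupoid.inv (δ : x ⟶ x) ≫ γ₀⟩
  have hj : Function.Injective j := by
    intro δ ε h
    have h1 : Groupoid.inv (δ : x ⟶ x) ≫ γ₀ = Groupoid.inv (ε : x ⟶ x) ≫ γ₀ := by
      simpa [j] using h
    exact inv_injective (G := End x) ((cancel_mono γ₀).1 h1)
  let b : End x →₀ O.stalk x := Finsupp.comapDomain j (kernelRow f.2 γ) hj.injOn
  have hb : b = 0 := by
    refine hV b fun v => ?_
    have h1 : kernelAct f.2 (bump (⟨y, γ₀⟩ : Star x) v) γ = 0 := by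
      have := congrArg Subtype.val (DFunLike.congr_fun hf ⟨bump ⟨y, γ₀⟩ v, bump_mem _ v⟩)
      exact congrFun this γ
    rw [kernelAct_apply] at h1
    rw [← h1, Finsupp.sum, ← finsum_eq_sum_of_support_subset (f := fun δ => b δ • δ • v)]
    · rw [← finsum_mem_univ (fun η => kernel _ _ η • _),
        ← finsum_mem_inter_support_eq (s := Set.range j), finsum_mem_range hj]
      · refine finsum_congr fun δ => ?_
        rw [bump_apply]
        congr 2
        simp [Groupoid.inv_eq_inv]
      · ext η
        simp only [Set.mem_inter_iff, Set.mem_univ, true_and, and_iff_right_iff_imp]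
        intro hη
        have h2 : η.1 = y := by
          by_contra h
          exact hη (by dsimp only; rw [bump_apply_of_ne h, smul_zero])
        obtain ⟨_, η⟩ := η
        obtain rfl := h2
        refine ⟨(End.of (γ₀ ≫ Groupoid.inv η)), ?_⟩
        simp [j, Groupoid.inv_eq_inv]
    · intro δ hδ
      rw [Finset.mem_coe, Finsupp.mem_support_iff]
      intro h0
      exact hδ (by dsimp only; rw [h0, zero_smul])
  -- With `γ = βγ₀`, the coefficient at the identity is `α_{γ⁻¹}(f(β))`, and `α_{γ⁻¹}` is
  -- invertible.
  have h1 : kernel f.1 γ (j 1) = 0 := DFunLike.congr_fun hb 1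
  have h2 : Groupoid.inv (j 1).2 ≫ γ.2 = β := by
    simp [j, γ, Groupoid.inv_eq_inv]
  unfold kernel at h1
  rw [h2] at h1
  rw [← act_act_inv γ.2 (f.1 ⟨β⟩), h1, map_zero]

end Induced

end Induction

/-! ### The second implication. -/

section LeftPrimitive

variable {X : Type u} [Groupoid.{v} X] [TopologicalSpace X] [TopologicalSpace (Arr X)]
  [IsAmpleGroupoid X] {O : RingSheaf.{u, v, w} X}

open SkewMonoidAlgebra in
/-- If the isotropy skew group ring at `x` is left primitive and the restriction to the orbit of
`x` is injective, then the convolution ring is left primitive. -/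
theorem isLeftPrimitive_of_isotropyRing (x : X)
    (hx : ∀ f : O.Gamma, (∀ γ : Arr X, γ.d ∈ Orb x → f.1 γ = 0) → f = 0)
    (h : IsLeftPrimitive (O.isotropyRing x)) : IsLeftPrimitive O.Gamma := by
  obtain ⟨V, _, ρ, hinj, ⟨r, m, hrm⟩, hsimple⟩ := h
  -- Unitality is not part of the definition of a module here. The elements killed by the ring form
  -- a proper submodule, hence 0, and it contains every `ρ 1 v - v`.
  have hone : ∀ v, ρ 1 v = v := by
    intro v
    let K : AddSubgroup V :=
      { carrier := {v | ∀ b, ρ b v = 0}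
        zero_mem' := fun b => (ρ b).map_zero
        add_mem' := fun {v w} hv hw b => by rw [map_add, hv b, hw b, add_zero]
        neg_mem' := fun {v} hv b => by rw [map_neg, hv b, neg_zero] }
    have hK : K = ⊥ := by
      refine (hsimple K fun b n hn c => ?_).resolve_right fun h => hrm ?_
      · rw [hn b, map_zero]
      · have : m ∈ K := h ▸ AddSubgroup.mem_top m
        exact this r
    have h1 : ρ 1 v - v ∈ K := fun b => by
      have h2 : ρ b (ρ 1 v) = ρ (b * 1) v := by rw [map_mul]; rfl
      rw [map_sub, h2, mul_one, sub_self]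
    rw [hK] at h1
    exact sub_eq_zero.1 h1
  let ρ' : O.isotropyRing x →+* AddMonoid.End V :=
    { ρ with map_one' := AddMonoidHom.ext hone }
  let iO : O.stalk x →+* O.isotropyRing x :=
    { toFun := single 1
      map_one' := rfl
      map_zero' := single_zero 1
      map_add' := single_add 1
      map_mul' := fun a b => by rw [single_mul_single, one_mul, one_smul] }
  let iG : End x →* O.isotropyRing x :=
    { toFun := fun δ => single δ 1
      map_one' := rfl
      map_mul' := fun δ ε => by rw [single_mul_single, smul_one, one_mul] }
  let _ : Module (O.stalk x) V := Module.compHom V (ρ'.comp iO)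
  let _ : DistribMulAction (End x) V :=
    DistribMulAction.compHom V ((ρ' : O.isotropyRing x →* AddMonoid.End V).comp iG)
  have smul_eq : ∀ (a : O.stalk x) (δ : End x) (v : V), a • δ • v = ρ (single δ a) v := by
    intro a δ v
    have h1 : (single δ a : O.isotropyRing x) = single 1 a * single δ 1 := by
      rw [single_mul_single, one_mul, one_smul, mul_one]
    rw [h1, map_mul]
    rfl
  -- This is the skew relation `δ a = α_δ(a) δ` in `B_x`, read on `V`.
  have : SMulDistribClass (End x) (O.stalk x) V := ⟨fun δ a v => by
    rw [smul_eq]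
    have h1 : (single δ (δ • a) : O.isotropyRing x) = single δ 1 * single 1 a := by
      rw [single_mul_single, mul_one, one_mul]
    rw [h1, map_mul]
    rfl⟩
  have hcyc : ∀ v : V, v ≠ 0 → ∀ P : AddSubgroup V,
      (∀ (a : O.stalk x) (δ : End x), a • δ • v ∈ P) → P = ⊤ := by
    intro v hv P hP
    let e : O.isotropyRing x →+ V :=
      (AddMonoidHom.eval v).comp (ρ'.toAddMonoidHom)
    -- The orbit map of a nonzero vector has a nonzero submodule as its range, so `V` is cyclic on
    -- `v`; the monomials `a δ` span the ring additively.
    have he : e.range = ⊤ := by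
      refine (hsimple e.range ?_).resolve_left fun h => hv ?_
      · rintro b _ ⟨c, rfl⟩
        exact ⟨b * c, by change ρ (b * c) v = ρ b (ρ c v); rw [map_mul]; rfl⟩
      · have h1 : v ∈ e.range := ⟨1, hone v⟩
        rw [h] at h1
        exact h1
    rw [eq_top_iff, ← he]
    rintro _ ⟨b, rfl⟩
    induction b using SkewMonoidAlgebra.induction_on with
    | zero => rw [map_zero]; exact zero_mem P
    | single δ a =>
      have := hP a δ
      rwa [smul_eq] at this
    | add b c hb hc => rw [map_add]; exact add_mem hb hc
  have hfaith : ∀ b : End x →₀ O.stalk x,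
      (∀ v : V, b.sum (fun δ a => a • δ • v) = 0) → b = 0 := by
    intro b hb
    have h1 : (⟨b⟩ : O.isotropyRing x) = 0 := by
      refine hinj (AddMonoidHom.ext fun v => ?_)
      rw [← sum_single (⟨b⟩ : O.isotropyRing x), sum_def, map_zero]
      refine Eq.trans ?_ (hb v)
      simp only [Finsupp.sum, _root_.map_sum, smul_eq]
      exact AddMonoidHom.finsetSum_apply _ _ _
    exact ofCoeff_eq_zero.1 h1
  have hne : m ≠ 0 := by
    rintro rfl
    exact hrm (map_zero _)
  refine ⟨induced x V, inferInstance, inducedRep O x V, ?_, ?_, inducedRep_simple hcyc⟩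
  · refine (injective_iff_map_eq_zero _).2 fun f hf => hx f fun γ hγ => ?_
    exact apply_eq_zero_of_inducedRep_eq_zero hfaith hf γ hγ
  · let γ : Star x := ⟨x, 𝟙 x⟩
    -- With coefficient 1 and trivial isotropy element, `f` fixes the bump of the nonzero vector
    -- `m`, so the action is not zero.
    obtain ⟨f, hf⟩ := exists_inducedRep_eq_bump (O := O) ⟨bump γ m, bump_mem γ m⟩ γ γ 1 1
    refine ⟨f, ⟨bump γ m, bump_mem γ m⟩, fun h => hne ?_⟩
    have h1 := congrFun (hf.symm.trans (congrArg Subtype.val h)) γ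
    rw [bump_apply_self, one_smul, one_smul] at h1
    exact (bump_apply_self γ m).symm.trans h1

end LeftPrimitive

end RingSheaf

end AmpleGroupoid

open AmpleGroupoid in
theorem theoremt {X : Type u} [Groupoid.{v} X] [TopologicalSpace X] [TopologicalSpace (Arr X)]
    [IsAmpleGroupoid X] (O : RingSheaf.{u, v, w} X) :
    (IsLeftPrimitive O.Gamma →
      ∃ x : X, ∀ f : O.Gamma, (∀ γ : Arr X, γ.d ∈ Orb x → f γ = 0) → f = 0) ∧
    (∀ x : X,
      (∀ f : O.Gamma, (∀ γ : Arr X, γ.d ∈ Orb x → f γ = 0) → f = 0) →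
      IsLeftPrimitive (O.isotropyRing x) →
      IsLeftPrimitive O.Gamma) :=
  ⟨RingSheaf.exists_orbit_of_isLeftPrimitive, RingSheaf.isLeftPrimitive_of_isotropyRing⟩
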